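/- **Theorem 1.2 (Pohozaev–Chou–Wang type identity).** Let $n\ge 1$ and $p\le -n-1$. Let $A$ be a real trace-free $n\times n$ matrix, $B,C\in\mathbb R^n$ and $D\in\mathbb R$. For $\varepsilon\in\{-1,1\}$ let $$T_\varepsilon(x)=\frac{(x,\varepsilon)}{\sqrt{1+|x|^2}}\qquad(x\in\mathbb R^n),$$ which parametrizes the open southern ($\varepsilon=-1$) and northern ($\varepsilon=1$) hemisphere of $\mathbb S^n\subset\mathbb R^{n+1}$. Let $$\xi_\varepsilon(x)=-\varepsilon(C\cdot x)\,x+Ax-Dx+\varepsilon B ,\qquad \sigma_\varepsilon=\tfrac1{n+1}\operatorname{div}\xi_\varepsilon ,$$ so that $\xi_{-1}(x)=(C\cdot x)x+Ax-Dx-B$, and $\xi_{1}$ is obtained from it by replacing $(B,C)$ by $(-B,-C)$. Then there are a continuous tangent vector field $\xi$ on $\mathbb S^n$ (the projective vector field) and a Lipschitz function $\beta$ on $\mathbb S^n$ such that, for both signs $\varepsilon$ and all $x\in\mathbb R^n$, $$\xi(T_\varepsilon(x))=dT_\varepsilon(x)\,[\xi_\varepsilon(x)],$$ $$\beta(T_\varepsilon(x))=\operatorname{div}\xi_\varepsilon(x)+p\,\sigma_\varepsilon(x)-(p+n+1)\frac{x\cdot\xi_\varepsilon(x)}{1+|x|^2}$$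 $$=\frac{p+n+1}{n+1}\cdot\frac{-\varepsilon(n+1)\,C\cdot x-D\,(n-|x|^2)-(n+1)\big(x\cdot Ax+\varepsilon B\cdot x\big)}{1+|x|^2},$$ and such that the following holds. For every $f\in C^1(\mathbb S^n)$ and every positive $h\in C^2(\mathbb S^n)$ that solves the $L_p$-Minkowski equation $$\det(\nabla^2_{ij}h+h\,\delta_{ij})=f\,h^{p-1}\quad\text{on }\mathbb S^n,$$ where $\nabla^2 h$ is the covariant Hessian in orthonormal frames, the function $K_f h^p$ with $K_f=\nabla_\xi f+\beta f$ is integrable on $\mathbb S^n$ and $$\int_{\mathbb S^n}K_f\,h^p\,d\sigma_{\mathbb S^n}=0 .$$ -/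

import Mathlib

open scoped Manifold ContDiff

namespace LpMinkowski

/-- The unit sphere `S^n` in `ℝ^{n+1}`. -/
abbrev Sph (n : ℕ) : Type :=
  Metric.sphere (0 : EuclideanSpace ℝ (Fin (n + 1))) 1

/-! ### Calculus on the sphere -/

/-- The extension of `u : S^n → ℝ` to `ℝ^{n+1} \ {0}` that is constant along rays,
`y ↦ u (y / |y|)` (with value `0` at the origin, which plays no role). -/
noncomputable def radialExt {n : ℕ} (u : Sph n → ℝ) (y : EuclideanSpace ℝ (Fin (n + 1))) : ℝ :=
  open Classical in
  if hy : y = 0 then 0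
  else u ⟨‖y‖⁻¹ • y, by
    rw [mem_sphere_zero_iff_norm, norm_smul, norm_inv, norm_norm,
      inv_mul_cancel₀ (norm_ne_zero_iff.mpr hy)]⟩

/-- The derivative `∇_v u (X)` of `u : S^n → ℝ` at `X` in the direction of a vector `v ∈ T_X S^n`,
tangent vectors being regarded as vectors of `ℝ^{n+1}` orthogonal to `X`. -/
noncomputable def dirDeriv {n : ℕ} (u : Sph n → ℝ) (X : Sph n)
    (v : EuclideanSpace ℝ (Fin (n + 1))) : ℝ :=
  fderiv ℝ (radialExt u) (X : EuclideanSpace ℝ (Fin (n + 1))) v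

/-- The covariant Hessian `∇²u (v, w)` at `X` of `u : S^n → ℝ`, for the round metric and
`v, w ∈ T_X S^n`. The radial extension of `u` has vanishing radial derivative, so its Euclidean
second derivative, restricted to `T_X S^n`, is the covariant Hessian of `u` (it gives the second
derivative of `u` along the great circle `t ↦ cos t • X + sin t • v` for a unit vector `v`). -/
noncomputable def hess {n : ℕ} (u : Sph n → ℝ) (X : Sph n)
    (v w : EuclideanSpace ℝ (Fin (n + 1))) : ℝ :=
  fderiv ℝ (fderiv ℝ (radialExt u)) (X : EuclideanSpace ℝ (Fin (n + 1))) v w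

/-- The surface measure `dσ` of `S^n`. -/
noncomputable def surfaceMeasure (n : ℕ) : MeasureTheory.Measure (Sph n) :=
  (MeasureTheory.volume : MeasureTheory.Measure (EuclideanSpace ℝ (Fin (n + 1)))).toSphere

/-- `h` is a (classical, positive) solution of the `L_p`-Minkowski equation
`det (∇²_{ij} h + h δ_{ij}) = f h^{p-1}` on `S^n`, the Hessian acting on orthonormal frames. -/
structure IsSolution (n : ℕ) (p : ℝ) (f h : Sph n → ℝ) : Prop where
  contMDiff : ContMDiff (𝓡 n) 𝓘(ℝ) 2 h
  pos : ∀ X, 0 < h X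
  eqn : ∀ (X : Sph n)
    (e : OrthonormalBasis (Fin n) ℝ (ℝ ∙ (X : EuclideanSpace ℝ (Fin (n + 1))))ᗮ),
    (Matrix.of fun i j : Fin n =>
      hess h X (e i) (e j) + h X * (1 : Matrix (Fin n) (Fin n) ℝ) i j).det = f X * h X ^ (p - 1)

/-! ### Central projection of the two open hemispheres -/

/-- The point `(x, t)` of `ℝ^n × ℝ = ℝ^{n+1}`. -/
def pair {n : ℕ} (x : EuclideanSpace ℝ (Fin n)) (t : ℝ) : EuclideanSpace ℝ (Fin (n + 1)) :=
  WithLp.toLp 2 (Fin.snoc (α := fun _ => ℝ) (fun i => x i) t)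

theorem norm_sq_pair {n : ℕ} (x : EuclideanSpace ℝ (Fin n)) (t : ℝ) :
    ‖pair x t‖ ^ 2 = ‖x‖ ^ 2 + t ^ 2 := by
  rw [EuclideanSpace.real_norm_sq_eq, EuclideanSpace.real_norm_sq_eq, Fin.sum_univ_castSucc]
  simp [pair]

/-- The inverse `x ↦ (x, ε) / √(1 + |x|²)` of the central projection of an open hemisphere onto
the hyperplane `x_{n+1} = ε`, for `ε = ±1`. The southern hemisphere is `ε = -1`, the northern one
is `ε = 1`. -/
noncomputable def proj {n : ℕ} (ε : ℤˣ) (x : EuclideanSpace ℝ (Fin n)) : Sph n :=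
  ⟨(√(1 + ‖x‖ ^ 2))⁻¹ • pair x ((ε : ℤ) : ℝ), by
    have h0 : (0 : ℝ) < 1 + ‖x‖ ^ 2 := by positivity
    have h1 : ((ε : ℤ) : ℝ) ^ 2 = 1 := by
      rcases Int.units_eq_one_or ε with h | h <;> simp [h]
    have h2 : ‖pair x ((ε : ℤ) : ℝ)‖ = √(1 + ‖x‖ ^ 2) := by
      rw [← Real.sqrt_sq (norm_nonneg (pair x ((ε : ℤ) : ℝ))), norm_sq_pair, h1, add_comm]
    rw [mem_sphere_zero_iff_norm, norm_smul, h2, norm_inv, Real.norm_eq_abs,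
      abs_of_pos (Real.sqrt_pos.mpr h0), inv_mul_cancel₀ (Real.sqrt_pos.mpr h0).ne']⟩

/-- The differential of `proj ε` at `x`, applied to the vector `ζ`. -/
noncomputable def pushVec {n : ℕ} (ε : ℤˣ) (x ζ : EuclideanSpace ℝ (Fin n)) :
    EuclideanSpace ℝ (Fin (n + 1)) :=
  pair ((√(1 + ‖x‖ ^ 2))⁻¹ • ζ - (inner ℝ x ζ / √(1 + ‖x‖ ^ 2) ^ 3) • x)
    (-((ε : ℤ) : ℝ) * (inner ℝ x ζ / √(1 + ‖x‖ ^ 2) ^ 3))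

/-! ### The projective vector field and its zeroth order companion -/

/-- The vector field `(Cᵀx) x + (A x - D x) - B` on `ℝ^n`. -/
noncomputable def affField {n : ℕ} (A : Matrix (Fin n) (Fin n) ℝ) (B C : EuclideanSpace ℝ (Fin n))
    (D : ℝ) (x : EuclideanSpace ℝ (Fin n)) : EuclideanSpace ℝ (Fin n) :=
  (inner ℝ C x) • x + (A.toEuclideanLin x - D • x) - B

/-- The divergence `D_k ζ^k` of a vector field on `ℝ^n`. -/
noncomputable def divergence {n : ℕ} (ζ : EuclideanSpace ℝ (Fin n) → EuclideanSpace ℝ (Fin n))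
    (x : EuclideanSpace ℝ (Fin n)) : ℝ :=
  ∑ k : Fin n, fderiv ℝ (fun y => ζ y k) x (EuclideanSpace.single k 1)

/-- `div ζ + p σ - (p + n + 1) x_k ζ^k / (1 + |x|²)`, where `(n + 1) σ = div ζ`. -/
noncomputable def betaFun {n : ℕ} (p : ℝ)
    (ζ : EuclideanSpace ℝ (Fin n) → EuclideanSpace ℝ (Fin n))
    (x : EuclideanSpace ℝ (Fin n)) : ℝ :=
  divergence ζ x + p * (divergence ζ x / (n + 1))
    - (p + n + 1) * (inner ℝ x (ζ x) / (1 + ‖x‖ ^ 2))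

/-- The closed form of `betaFun p (affField A B C D)` for a trace free matrix `A`. -/
noncomputable def betaExplicit {n : ℕ} (p : ℝ) (A : Matrix (Fin n) (Fin n) ℝ)
    (B C : EuclideanSpace ℝ (Fin n)) (D : ℝ) (x : EuclideanSpace ℝ (Fin n)) : ℝ :=
  (p + n + 1) / (n + 1) *
    (((n + 1) * inner ℝ C x - D * (n - ‖x‖ ^ 2)
      - (n + 1) * (inner ℝ x (A.toEuclideanLin x) - inner ℝ B x)) / (1 + ‖x‖ ^ 2))

end LpMinkowski

open LpMinkowski

/-! The projective field is the tangential part of a linear field `X ↦ M X` on `ℝ^{n+1}` with `tr M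
= 0`, and `β X = -(p + n + 1) ⟪X, M X⟫`. Both are therefore defined across the equator at once, and
the identity to prove is linear in `M`. Trace-free matrices are spanned by the rank one maps `X ↦
⟪v, X⟫ u` with `u ⊥ v`, so these suffice (`integral_trace_zero`).

For such a map, integrate `⟪v, X⟫ ∂_u (f h^p)` by parts on the sphere
(`integral_sphere_inner_mul_fderiv`). The derivative falling on `h^p` gives `p f h^{p-1} ∂_u h`. By
the equation, `f h^{p-1}` is the density of the surface area measure, and `∂_u h + h ⟪u, X⟫ = ⟪u,
Y⟫`, where `Y` is the gradient of the 1-homogeneous extension of `h`. What remains is that `∫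
det(∇²h + h I) ⟪X, v⟫ ⟪u, Y⟫` vanishes: the first variation of volume under the shears `1 + t v ⊗ u`
is zero.

That vanishing (`integral_det_mul_inner_supportGradient`) comes from the null Lagrangian property of
the Jacobian, applied to the compactly supported map `a(|y|) (Y + |y| ⟪u, Y⟫ v)`. As `h` is only
`C²`, this map is only `C¹`, so the null Lagrangian property is obtained by change of variables,
without second derivatives. -/

/-! ### The Jacobian determinant of a compactly supported `C¹` map has integral zero. -/

open MeasureTheory Set Metric Filter Topology Polynomial in
-- Allows `det L` to be read off as the top coefficient of a polynomial known only through its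
-- values at small `t`.
theorem LinearMap.det_one_add_smul_eq_eval {V : Type*} [AddCommGroup V] [Module ℝ V]
    [FiniteDimensional ℝ V] (L : V →ₗ[ℝ] V) :
    ∃ P : ℝ[X], P.natDegree ≤ Module.finrank ℝ V ∧
      P.coeff (Module.finrank ℝ V) = LinearMap.det L ∧
      ∀ t : ℝ, P.eval t = LinearMap.det (1 + t • L) := by
  let b := Module.finBasis ℝ V
  let M := LinearMap.toMatrix b b L
  refine ⟨((X : ℝ[X]) • M.map C + (1 : Matrix _ _ ℝ).map C).det, ?_, ?_, fun t => ?_⟩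
  · simpa using natDegree_det_X_add_C_le M 1
  · have := coeff_det_X_add_C_card M 1
    rw [Fintype.card_fin] at this
    rw [this, LinearMap.det_toMatrix]
  · rw [← coe_evalRingHom, RingHom.map_det, ← LinearMap.det_toMatrix b]
    rw [map_add (LinearMap.toMatrix b b), map_smul (LinearMap.toMatrix b b),
      LinearMap.toMatrix_one]
    change _ = (1 + t • M).det
    congr 1
    ext i j
    by_cases h : i = j
    · subst h
      simp only [RingHom.mapMatrix_apply, Matrix.map_apply, Matrix.add_apply, Matrix.smul_apply,
        Matrix.one_apply_eq, coe_evalRingHom, smul_eq_mul, eval_add, eval_mul, eval_X, eval_C]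
      ring
    · simp only [RingHom.mapMatrix_apply, Matrix.map_apply, Matrix.add_apply, Matrix.smul_apply,
        Matrix.one_apply_ne h, coe_evalRingHom, smul_eq_mul, eval_add, eval_mul, eval_X, eval_C]
      ring

-- For small `t` the map `x ↦ x + t Θ x` is a bijection with positive Jacobian that fixes everything
-- outside the ball, so it carries the ball onto itself and preserves its total volume.
open MeasureTheory Set Metric Filter Topology in
theorem integral_ball_det_one_add_smul_fderiv {E : Type*} [NormedAddCommGroup E] [NormedSpace ℝ E]
    [FiniteDimensional ℝ E] [MeasurableSpace E] [BorelSpace E] (μ : Measure E)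
    {Θ : E → E} (hΘ : ContDiff ℝ 1 Θ) (hc : HasCompactSupport Θ) [μ.IsAddHaarMeasure]
    {R : ℝ} (hR : tsupport Θ ⊆ ball 0 R) :
    ∃ η > 0, ∀ t : ℝ, 0 ≤ t → t ≤ η →
      ∫ x in ball 0 R, (1 + t • fderiv ℝ Θ x).det ∂μ = μ.real (ball 0 R) := by
  obtain ⟨K, hK⟩ := ContDiff.lipschitzWith_of_hasCompactSupport hc hΘ one_ne_zero
  have hdet : ∀ᶠ L in 𝓝 (0 : E →L[ℝ] E), 0 < (1 + L).det := by
    have h1 : Continuous fun L : E →L[ℝ] E => (1 + L).det :=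
      ContinuousLinearMap.continuous_det.comp (continuous_const.add continuous_id)
    refine h1.continuousAt.eventually (lt_mem_nhds ?_)
    simp [ContinuousLinearMap.det]
  obtain ⟨ε, hε, hdet⟩ := Metric.eventually_nhds_iff.1 hdet
  have hK1 : (0 : ℝ) < K + 1 := by positivity
  -- The first bound makes `t Θ` a contraction, the second keeps `t DΘ` where `det (1 + ·) > 0`; `K
  -- + 1` replaces `K` to avoid dividing by zero.
  refine ⟨min (1 / (2 * (K + 1))) (ε / (2 * (K + 1))), by positivity, fun t ht0 ht => ?_⟩
  have htK : t * (K + 1) < 1 := by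
    have := (le_min_iff.1 ht).1
    rw [le_div_iff₀ (by positivity)] at this
    linarith
  have htε : t * (K + 1) < ε := by
    have := (le_min_iff.1 ht).2
    rw [le_div_iff₀ (by positivity)] at this
    linarith
  have htK' : t * K < 1 := by nlinarith
  have hlip : LipschitzWith (t.toNNReal * K) fun x => t • Θ x := by
    have := (lipschitzWith_smul t).comp hK
    rwa [show ‖t‖₊ = t.toNNReal by ext; simp [ht0]] at this
  have hlt : t.toNNReal * K < 1 := by
    rw [← NNReal.coe_lt_coe]; simpa [ht0] using htK'
  set g : E → E := fun x => x + t • Θ x with hg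
  have happ : ApproximatesLinearOn g ((ContinuousLinearEquiv.refl ℝ E : E ≃L[ℝ] E) : E →L[ℝ] E)
      univ (t.toNNReal * K) := by
    rw [ApproximatesLinearOn.approximatesLinearOn_iff_lipschitzOnWith, lipschitzOnWith_univ]
    convert hlip using 1
    ext x
    simp [hg]
  have hN : Subsingleton E ∨ t.toNNReal * K <
      ‖((ContinuousLinearEquiv.refl ℝ E).symm : E →L[ℝ] E)‖₊⁻¹ := by
    rcases subsingleton_or_nontrivial E with h | h
    · exact Or.inl h
    · right
      have : ‖((ContinuousLinearEquiv.refl ℝ E).symm : E →L[ℝ] E)‖₊ = 1 := by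
        ext; simp
      rw [this]; simpa using hlt
  have hinj : Function.Injective g := injOn_univ.1 (happ.injOn hN)
  have hsurj : Function.Surjective g := happ.surjective hN
  have hout : ∀ x, x ∉ ball (0 : E) R → g x = x := fun x hx => by
    simp [hg, image_eq_zero_of_notMem_tsupport fun h => hx (hR h)]
  have himage : g '' ball 0 R = ball 0 R := by
    have : g '' (ball 0 R)ᶜ = (ball 0 R)ᶜ := by
      exact (image_congr fun x hx => hout x hx).trans (image_id' _)
    rw [image_compl_eq ⟨hinj, hsurj⟩] at this
    exact compl_injective this
  have hder : ∀ x, HasFDerivAt g (1 + t • fderiv ℝ Θ x) x := fun x =>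
    (hasFDerivAt_id x).add ((hΘ.differentiable one_ne_zero x).hasFDerivAt.const_smul t)
  have hpos : ∀ x, 0 < (1 + t • fderiv ℝ Θ x).det := fun x => by
    refine hdet ?_
    rw [dist_zero_right, norm_smul, Real.norm_of_nonneg ht0]
    have := norm_fderiv_le_of_lipschitz ℝ hK (x₀ := x)
    nlinarith
  have := integral_image_eq_integral_abs_det_fderiv_smul μ measurableSet_ball
    (fun x _ => (hder x).hasFDerivWithinAt) (hinj.injOn (s := ball 0 R)) fun _ => (1 : ℝ)
  rw [himage] at this
  simpa [abs_of_pos (hpos _)] using this.symm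

open MeasureTheory Set Metric Filter Topology Polynomial in
/-- The Jacobian determinant is a null Lagrangian. -/
theorem integral_det_fderiv_eq_zero {E : Type*} [NormedAddCommGroup E] [NormedSpace ℝ E]
    [FiniteDimensional ℝ E] [Nontrivial E] [MeasurableSpace E] [BorelSpace E] (μ : Measure E)
    [μ.IsAddHaarMeasure] {Θ : E → E} (hΘ : ContDiff ℝ 1 Θ) (hc : HasCompactSupport Θ) :
    ∫ x, (fderiv ℝ Θ x).det ∂μ = 0 := by
  obtain ⟨R, hR⟩ := hc.isCompact.isBounded.subset_ball (0 : E)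
  obtain ⟨η, hη, hvol⟩ := integral_ball_det_one_add_smul_fderiv μ hΘ hc hR
  set N := Module.finrank ℝ E with hN
  have hNpos : 0 < N := Module.finrank_pos
  -- `N + 1` distinct nodes in `[0, η]`, enough to interpolate a polynomial of degree `N`.
  let v : ℕ → ℝ := fun j => η * (j / (N + 1))
  let s := Finset.range (N + 1)
  have hv : InjOn v s := by
    intro i _ j _ hij
    have h1 : (N : ℝ) + 1 ≠ 0 := by positivity
    have := mul_left_cancel₀ hη.ne' hij
    rw [div_left_inj' h1] at this
    exact_mod_cast this
  let w : ℕ → ℝ := fun i => ∏ j ∈ s.erase i, (v i - v j)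
  have hcard : s.card - 1 = N := by simp [s]
  have hpt : ∀ x, (fderiv ℝ Θ x).det = ∑ i ∈ s, (1 + v i • fderiv ℝ Θ x).det / w i := by
    intro x
    obtain ⟨P, hdeg, hcoeff, heval⟩ :=
      LinearMap.det_one_add_smul_eq_eval (fderiv ℝ Θ x : E →ₗ[ℝ] E)
    have := Lagrange.coeff_eq_sum hv (P := P) (by
      refine lt_of_le_of_lt degree_le_natDegree ?_
      rw [Finset.card_range]
      exact_mod_cast Nat.lt_succ_of_le hdeg)
    rw [hcard, hcoeff] at this
    rw [ContinuousLinearMap.det, this]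
    refine Finset.sum_congr rfl fun i _ => ?_
    rw [heval]; rfl
  -- The same interpolation formula applied to the constant `1`, whose coefficient of degree `N ≥ 1`
  -- is zero. Since the integral at every node equals the same volume, this sum is what remains of
  -- the total.
  have hone : ∑ i ∈ s, 1 / w i = 0 := by
    have := Lagrange.coeff_eq_sum hv (P := (1 : ℝ[X])) (by
      refine lt_of_le_of_lt degree_one_le ?_
      rw [Finset.card_range]
      exact_mod_cast Nat.succ_pos N)
    rw [hcard, coeff_one, if_neg hNpos.ne'] at this
    simpa using this.symm
  have hcont : ∀ t : ℝ, Continuous fun x => (1 + t • fderiv ℝ Θ x).det := fun t =>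
    ContinuousLinearMap.continuous_det.comp
      (continuous_const.add ((hΘ.continuous_fderiv one_ne_zero).const_smul t))
  have hball : ∫ x, (fderiv ℝ Θ x).det ∂μ = ∫ x in ball 0 R, (fderiv ℝ Θ x).det ∂μ := by
    refine (setIntegral_eq_integral_of_forall_compl_eq_zero fun x hx => ?_).symm
    have : fderiv ℝ Θ x = 0 := by
      by_contra h
      exact hx (hR (support_fderiv_subset ℝ h))
    rw [this, ContinuousLinearMap.det, ContinuousLinearMap.toLinearMap_zero,
      LinearMap.det_zero, zero_pow hNpos.ne']
  rw [hball]
  simp_rw [hpt]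
  rw [integral_finsetSum]
  · have : ∀ i ∈ s, ∫ x in ball 0 R, (1 + v i • fderiv ℝ Θ x).det / w i ∂μ
        = μ.real (ball 0 R) * (1 / w i) := fun i hi => by
      rw [integral_div, hvol (v i) (by positivity), mul_one_div]
      have : ((i : ℝ) / (N + 1)) ≤ 1 := by
        rw [div_le_one (by positivity)]
        exact_mod_cast (Finset.mem_range.1 hi).le
      exact mul_le_of_le_one_right hη.le this
    rw [Finset.sum_congr rfl this, ← Finset.mul_sum, hone, mul_zero]
  · intro i _
    exact (((hcont (v i)).continuousOn.integrableOn_compact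
      (isCompact_closedBall 0 R)).mono_set ball_subset_closedBall).div_const _

/-! ### Polar coordinates for sums of two separated terms. -/

open MeasureTheory Set Metric Measure in
theorem integral_volumeIoiPow (n : ℕ) {φ a : ℝ → ℝ} (ha : IntegrableOn a (Ioi 0))
    (h : ∀ r, 0 < r → φ r * r ^ n = a r) :
    Integrable (fun r : Ioi (0 : ℝ) => φ r) (volumeIoiPow n) ∧
      ∫ r : Ioi (0 : ℝ), φ r ∂(volumeIoiPow n) = ∫ r in Ioi 0, a r := by
  have hm : Measurable fun r : Ioi (0 : ℝ) => Real.toNNReal (r.1 ^ n) :=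
    (measurable_subtype_coe.pow_const _).real_toNNReal
  have he : ∀ r : Ioi (0 : ℝ), Real.toNNReal (r.1 ^ n) • φ r = a r := fun r => by
    rw [NNReal.smul_def, Real.coe_toNNReal _ (pow_nonneg r.2.out.le _), smul_eq_mul, mul_comm,
      h r r.2]
  constructor
  · simp only [volumeIoiPow, ENNReal.ofReal]
    rw [integrable_withDensity_iff_integrable_smul hm]
    simp_rw [he]
    exact (integrableOn_iff_comap_subtypeVal measurableSet_Ioi).1 ha
  · simp only [volumeIoiPow, ENNReal.ofReal]
    rw [integral_withDensity_eq_integral_smul hm]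
    simp_rw [he]
    exact integral_subtype_comap measurableSet_Ioi a

open MeasureTheory Set Metric Measure in
theorem integral_eq_of_polar {E : Type*} [NormedAddCommGroup E] [NormedSpace ℝ E]
    [FiniteDimensional ℝ E] [Nontrivial E] [MeasurableSpace E] [BorelSpace E] (μ : Measure E)
    [μ.IsAddHaarMeasure] {n : ℕ} (hn : Module.finrank ℝ E = n + 1) {Φ : E → ℝ} {a b : ℝ → ℝ}
    {k l : sphere (0 : E) 1 → ℝ} (ha : IntegrableOn a (Ioi 0)) (hb : IntegrableOn b (Ioi 0))
    (hk : Integrable k μ.toSphere) (hl : Integrable l μ.toSphere)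
    (h : ∀ (r : ℝ) (X : sphere (0 : E) 1), 0 < r →
      Φ (r • (X : E)) * r ^ n = a r * k X + b r * l X) :
    ∫ y, Φ y ∂μ = (∫ r in Ioi 0, a r) * ∫ X, k X ∂μ.toSphere
      + (∫ r in Ioi 0, b r) * ∫ X, l X ∂μ.toSphere := by
  obtain ⟨ha1, ha2⟩ := integral_volumeIoiPow n (φ := fun r => a r / r ^ n) ha
    fun r hr => div_mul_cancel₀ _ (by positivity)
  obtain ⟨hb1, hb2⟩ := integral_volumeIoiPow n (φ := fun r => b r / r ^ n) hb
    fun r hr => div_mul_cancel₀ _ (by positivity)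
  let Ψ : sphere (0 : E) 1 × Ioi (0 : ℝ) → ℝ :=
    fun z => k z.1 * (a z.2 / z.2.1 ^ n) + l z.1 * (b z.2 / z.2.1 ^ n)
  have hd : Module.finrank ℝ E - 1 = n := by omega
  calc ∫ y, Φ y ∂μ = ∫ x : ({(0)}ᶜ : Set E), Φ x.1 ∂(μ.comap (↑)) := by
        rw [integral_subtype_comap (measurableSet_singleton _).compl fun x ↦ Φ x,
          restrict_compl_singleton]
    _ = ∫ x : ({(0)}ᶜ : Set E), Ψ (homeomorphUnitSphereProd E x) ∂(μ.comap (↑)) := by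
        refine integral_congr_ae (.of_forall fun x => ?_)
        have hx : 0 < ‖x.1‖ := norm_pos_iff.2 x.2
        have := h ‖x.1‖ (homeomorphUnitSphereProd E x).1 hx
        simp only [homeomorphUnitSphereProd_apply_fst_coe, smul_inv_smul₀ hx.ne'] at this
        simp only [Ψ, homeomorphUnitSphereProd_apply_snd_coe]
        field_simp
        linarith
    _ = ∫ z, Ψ z ∂μ.toSphere.prod (volumeIoiPow n) := by
        rw [← hd]
        exact μ.measurePreserving_homeomorphUnitSphereProd.integral_comp
          (Homeomorph.measurableEmbedding _) Ψ
    _ = _ := by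
        rw [integral_add (hk.mul_prod ha1) (hl.mul_prod hb1),
          integral_prod_mul k (fun r : Ioi (0 : ℝ) => a r / r.1 ^ n),
          integral_prod_mul l (fun r : Ioi (0 : ℝ) => b r / r.1 ^ n), ha2, hb2]
        ring

/-! ### A determinant in a frame adapted to a unit vector. -/

/-- If `S` kills the unit vector `X` and has image in `X^⊥`, the determinant of
`κ S + ⟪X, ·⟫ w` is computed from the compression of `S` to `X^⊥`. -/
theorem det_smul_add_inner_smul {E : Type*} [NormedAddCommGroup E] [InnerProductSpace ℝ E]
    [FiniteDimensional ℝ E] {n : ℕ} (hn : Module.finrank ℝ E = n + 1) {X : E} (hX : ‖X‖ = 1)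
    (e : OrthonormalBasis (Fin n) ℝ (ℝ ∙ X)ᗮ) {S T : E →ₗ[ℝ] E} (hSX : S X = 0)
    (hXS : ∀ z, inner ℝ X (S z) = 0) (κ : ℝ) (w : E)
    (hT : ∀ z, T z = κ • S z + inner ℝ X z • w) :
    LinearMap.det T = κ ^ n *
      (Matrix.of fun i j : Fin n => inner ℝ (e i : E) (S (e j))).det * inner ℝ X w := by
  have heX : ∀ i, inner ℝ X (e i : E) = 0 := fun i =>
    Submodule.mem_orthogonal_singleton_iff_inner_right.1 (e i).2
  let v : Fin n ⊕ Unit → E := Sum.elim (fun i => (e i : E)) fun _ => X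
  have hv : Orthonormal ℝ v := by
    rw [orthonormal_iff_ite]
    have he := orthonormal_iff_ite.1 e.orthonormal
    rintro (i | i) (j | j)
    · simpa [v] using he i j
    · simp [v, real_inner_comm, heX]
    · simp [v, heX]
    · simp [v, hX]
  let b : Module.Basis (Fin n ⊕ Unit) ℝ E :=
    basisOfOrthonormalOfCardEqFinrank hv (by simp [hn])
  have hb : ⇑b = v := coe_basisOfOrthonormalOfCardEqFinrank hv _
  let o : OrthonormalBasis (Fin n ⊕ Unit) ℝ E := b.toOrthonormalBasis (by rwa [hb])
  have ho : ⇑o = v := by simp [o, hb]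
  -- In the frame `(e, X)` the matrix is block upper triangular: `T` maps `e j` to `κ S (e j)`,
  -- which is orthogonal to `X`, and `X` to `w`.
  have hmat : LinearMap.toMatrix o.toBasis o.toBasis T = Matrix.fromBlocks
      (κ • Matrix.of fun i j : Fin n => inner ℝ (e i : E) (S (e j)))
      (Matrix.of fun (i : Fin n) (_ : Unit) => inner ℝ (e i : E) w) 0
      (Matrix.of fun (_ _ : Unit) => inner ℝ X w) := by
    ext i j
    rw [LinearMap.toMatrix_apply, OrthonormalBasis.coe_toBasis_repr_apply,
      OrthonormalBasis.repr_apply_apply, OrthonormalBasis.coe_toBasis, ho, hT]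
    rcases i with i | i <;> rcases j with j | j <;>
      simp [v, heX, hXS, hSX, hX, inner_smul_right]
  rw [← LinearMap.det_toMatrix o.toBasis, hmat, Matrix.det_fromBlocks_zero₂₁, Matrix.det_smul]
  simp

/-! ### Radial cutoffs and homogeneous functions. -/

section Radial

variable {E : Type*} [NormedAddCommGroup E] [InnerProductSpace ℝ E]

theorem hasFDerivAt_norm_of_ne_zero {y : E} (hy : y ≠ 0) :
    HasFDerivAt (fun z : E => ‖z‖) (‖y‖⁻¹ • innerSL ℝ y) y := by
  have h := ((hasFDerivAt_id y).norm_sq).sqrt (pow_ne_zero 2 (norm_ne_zero_iff.2 hy))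
  simp only [id, Real.sqrt_sq (norm_nonneg _)] at h
  convert! h using 1
  ext z
  have := norm_ne_zero_iff.2 hy
  simp
  field_simp

theorem fderiv_norm_mul_apply {g : E → ℝ} {y : E} (hy : y ≠ 0) (hg : DifferentiableAt ℝ g y)
    (z : E) : fderiv ℝ (fun z => ‖z‖ * g z) y z
      = ‖y‖ * fderiv ℝ g y z + g y * (‖y‖⁻¹ * inner ℝ y z) := by
  have h : HasFDerivAt (fun z => ‖z‖ * g z) _ y :=
    (hasFDerivAt_norm_of_ne_zero hy).mul hg.hasFDerivAt
  rw [h.fderiv]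
  simp

variable {F : Type*} [NormedAddCommGroup F] [NormedSpace ℝ F]

theorem hasFDerivAt_radial_smul {a : ℝ → ℝ} {G : E → F} {G' : E →L[ℝ] F} {y : E} (hy : y ≠ 0)
    (ha : DifferentiableAt ℝ a ‖y‖) (hG : HasFDerivAt G G' y) :
    HasFDerivAt (fun z => a ‖z‖ • G z)
      (a ‖y‖ • G' + ((deriv a ‖y‖ * ‖y‖⁻¹) • innerSL ℝ y).smulRight (G y)) y := by
  have h := (ha.hasDerivAt.comp_hasFDerivAt y (hasFDerivAt_norm_of_ne_zero hy)).smul hG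
  convert! h using 3
  rw [smul_smul]

/-- The cutoff vanishes on the unit ball, so a singularity of `G` at the origin is harmless. -/
theorem contDiff_radial_smul {a : ℝ → ℝ} {G : E → F} {k : ℕ∞} (ha : ContDiff ℝ k a)
    (ha0 : ∀ r ≤ 1, a r = 0) (hG : ∀ y ≠ 0, ContDiffAt ℝ k G y) :
    ContDiff ℝ k fun z => a ‖z‖ • G z := by
  rw [contDiff_iff_contDiffAt]
  intro y
  rcases eq_or_ne y 0 with rfl | hy
  · refine (contDiffAt_const (c := (0 : F))).congr_of_eventuallyEq ?_
    filter_upwards [Metric.ball_mem_nhds (0 : E) one_pos] with z hz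
    rw [ha0 _ (mem_ball_zero_iff.1 hz).le, zero_smul]
  · exact (ha.contDiffAt.comp y (contDiffAt_norm ℝ hy)).smul (hG y hy)

theorem hasCompactSupport_radial_smul [FiniteDimensional ℝ E] {a : ℝ → ℝ} (G : E → F) {R : ℝ}
    (ha : ∀ r, R ≤ r → a r = 0) : HasCompactSupport fun z => a ‖z‖ • G z := by
  refine HasCompactSupport.intro (isCompact_closedBall (0 : E) R) fun z hz => ?_
  rw [ha _ (not_le.1 fun h => hz (mem_closedBall_zero_iff.2 h)).le, zero_smul]

theorem fderiv_smul_of_homogeneous_zero {G : E → F} (hG : ∀ r : ℝ, 0 < r → ∀ y, G (r • y) = G y)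
    {r : ℝ} (hr : 0 < r) (y : E) : fderiv ℝ G (r • y) = r⁻¹ • fderiv ℝ G y := by
  have h := fderiv_comp_smul (𝕜 := ℝ) (f := G) (x := y) r
  simp only [hG r hr] at h
  rw [h, inv_smul_smul₀ hr.ne']

theorem fderiv_smul_of_homogeneous_one {G : E → F}
    (hG : ∀ r : ℝ, 0 < r → ∀ y, G (r • y) = r • G y)
    {r : ℝ} (hr : 0 < r) (y : E) : fderiv ℝ G (r • y) = fderiv ℝ G y := by
  have h := fderiv_comp_smul (𝕜 := ℝ) (f := G) (x := y) r
  simp only [hG r hr] at h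
  have h2 : fderiv ℝ (fun x => r • G x) y = r • fderiv ℝ G y :=
    congrFun (fderiv_const_smul_field (𝕜 := ℝ) (f := G) r) y
  exact (smul_right_injective _ hr.ne' (h2.symm.trans h)).symm

theorem fderiv_self_of_homogeneous_zero {G : E → F}
    (hG : ∀ r : ℝ, 0 < r → ∀ y, G (r • y) = G y) {y : E} (hd : DifferentiableAt ℝ G y) :
    fderiv ℝ G y y = 0 := by
  have hline : HasDerivAt (fun t : ℝ => G (t • y)) (fderiv ℝ G y y) 1 := by
    have h1 : HasDerivAt (fun t : ℝ => t • y) ((1 : ℝ) • y) 1 := (hasDerivAt_id 1).smul_const y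
    have h2 : HasFDerivAt G (fderiv ℝ G y) ((1 : ℝ) • y) := by
      rw [one_smul]; exact hd.hasFDerivAt
    simpa [Function.comp_def] using h2.comp_hasDerivAt 1 h1
  have hconst : HasDerivAt (fun t : ℝ => G (t • y)) 0 1 := by
    refine (hasDerivAt_const 1 (G y)).congr_of_eventuallyEq ?_
    filter_upwards [lt_mem_nhds (zero_lt_one' ℝ)] with t ht
    exact hG t ht y
  exact hline.unique hconst

end Radial

namespace LpMinkowski

variable {n : ℕ}

theorem radialExt_smul (u : Sph n → ℝ) {r : ℝ} (hr : 0 < r) (y : EuclideanSpace ℝ (Fin (n + 1))) :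
    radialExt u (r • y) = radialExt u y := by
  unfold radialExt
  by_cases hy : y = 0
  · simp [hy]
  · have hry : r • y ≠ 0 := smul_ne_zero hr.ne' hy
    rw [dif_neg hy, dif_neg hry]
    congr 2
    rw [norm_smul, Real.norm_of_nonneg hr.le, mul_inv, smul_smul, mul_right_comm,
      inv_mul_cancel₀ hr.ne', one_mul]

theorem radialExt_coe (u : Sph n → ℝ) (X : Sph n) :
    radialExt u (X : EuclideanSpace ℝ (Fin (n + 1))) = u X := by
  have hX : (X : EuclideanSpace ℝ (Fin (n + 1))) ≠ 0 := ne_zero_of_mem_unit_sphere X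
  rw [radialExt, dif_neg hX]
  congr 1
  ext1
  simp

/-- On the punctured space the extension is `u` composed with the normalization `y ↦ y / |y|`, a
smooth map into the sphere. -/
theorem contDiffAt_radialExt {k : ℕ∞} {u : Sph n → ℝ} (hu : ContMDiff (𝓡 n) 𝓘(ℝ) k u)
    {y : EuclideanSpace ℝ (Fin (n + 1))} (hy : y ≠ 0) : ContDiffAt ℝ k (radialExt u) y := by
  let U : TopologicalSpace.Opens (EuclideanSpace ℝ (Fin (n + 1))) :=
    ⟨{0}ᶜ, isOpen_compl_singleton⟩
  have : Fact (Module.finrank ℝ (EuclideanSpace ℝ (Fin (n + 1))) = n + 1) :=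
    ⟨finrank_euclideanSpace_fin⟩
  let N : U → EuclideanSpace ℝ (Fin (n + 1)) := fun z => ‖z.1‖⁻¹ • z.1
  have hN : ContMDiff 𝓘(ℝ, EuclideanSpace ℝ (Fin (n + 1)))
      𝓘(ℝ, EuclideanSpace ℝ (Fin (n + 1))) k N := by
    intro z
    refine (contMDiffAt_subtype_iff (f := fun z : EuclideanSpace ℝ (Fin (n + 1)) =>
      ‖z‖⁻¹ • z)).2 (ContDiffAt.contMDiffAt ?_)
    have hz : (z : EuclideanSpace ℝ (Fin (n + 1))) ≠ 0 := z.2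
    exact ((contDiffAt_norm ℝ hz).inv (norm_ne_zero_iff.2 hz)).smul contDiffAt_id
  have hN1 : ∀ z, N z ∈ Metric.sphere (0 : EuclideanSpace ℝ (Fin (n + 1))) 1 := fun z => by
    have hz : (z : EuclideanSpace ℝ (Fin (n + 1))) ≠ 0 := z.2
    rw [mem_sphere_zero_iff_norm, norm_smul, norm_inv, norm_norm,
      inv_mul_cancel₀ (norm_ne_zero_iff.mpr hz)]
  have hcod : ContMDiff 𝓘(ℝ, EuclideanSpace ℝ (Fin (n + 1))) (𝓡 n) k
      (Set.codRestrict N _ hN1 : U → Sph n) := hN.codRestrict_sphere hN1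
  have hcomp := hu.comp hcod
  rw [← contMDiffAt_iff_contDiffAt]
  refine (contMDiffAt_subtype_iff (U := U) (x := ⟨y, hy⟩)).1 ?_
  refine (hcomp ⟨y, hy⟩).congr_of_eventuallyEq (.of_forall fun z => ?_)
  have hz : (z : EuclideanSpace ℝ (Fin (n + 1))) ≠ 0 := z.2
  simp only [radialExt, dif_neg hz]
  rfl

end LpMinkowski

/-- The positive moments are the radial factors divided out after passing to polar coordinates: `j =
0`, `m = n` for integration by parts, `j = n`, `m = 0` for the determinant. -/
theorem exists_radial_cutoff : ∃ a : ℝ → ℝ, ContDiff ℝ ∞ a ∧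
    (∀ r ≤ 1, a r = 0) ∧ (∀ r, 3 ≤ r → a r = 0) ∧
    ∀ j m : ℕ, 0 < ∫ r in Set.Ioi 0, a r ^ (j + 1) * r ^ m := by
  let φ : ContDiffBump (2 : ℝ) := ⟨1 / 2, 1, by norm_num, by norm_num⟩
  have h0 : ∀ r, 1 ≤ |r - 2| → φ r = 0 := fun r hr => by
    refine φ.zero_of_le_dist ?_
    rwa [Real.dist_eq]
  have h1 : ∀ r ≤ 1, φ r = 0 := fun r hr => h0 r (le_abs.2 (Or.inr (by linarith)))
  refine ⟨φ, φ.contDiff, h1, fun r hr => h0 r (le_abs.2 (Or.inl (by linarith))),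
    fun j m => ?_⟩
  have hcont : Continuous fun r => φ r ^ (j + 1) * r ^ m := by
    have := φ.continuous
    fun_prop
  have hnn : ∀ r, 0 ≤ φ r ^ (j + 1) * r ^ m := fun r => by
    rcases le_total r 1 with h | h
    · simp [h1 r h]
    · have := φ.nonneg (x := r)
      positivity
  rw [MeasureTheory.setIntegral_eq_integral_of_forall_compl_eq_zero]
  · refine hcont.integral_pos_of_hasCompactSupport_nonneg_nonzero
      ((φ.hasCompactSupport.comp_left (g := (· ^ (j + 1))) (by simp)).mul_right) hnn (x := 2) ?_
    have : φ 2 = 1 := φ.one_of_mem_closedBall (by simp [φ.rIn_pos.le])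
    simp [this]
  · intro r hr
    rw [h1 r ((not_lt.1 hr).trans zero_le_one), zero_pow j.succ_ne_zero, zero_mul]

theorem hasCompactSupport_of_cutoff {a : ℝ → ℝ} (h1 : ∀ r ≤ 1, a r = 0)
    (h3 : ∀ r, 3 ≤ r → a r = 0) : HasCompactSupport a := by
  refine HasCompactSupport.intro (isCompact_Icc (a := (1 : ℝ)) (b := 3)) fun r hr => ?_
  by_cases h : r ≤ 1
  · exact h1 r h
  · exact h3 r (le_of_not_ge fun h' => hr ⟨(not_le.1 h).le, h'⟩)

/-! ### Integration by parts on the sphere. -/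

section SphereIntegrals

open MeasureTheory Set Metric

variable {E : Type*} [NormedAddCommGroup E] [InnerProductSpace ℝ E] [FiniteDimensional ℝ E]
  [MeasurableSpace E] [BorelSpace E] (μ : Measure E) [μ.IsAddHaarMeasure] {n : ℕ}

theorem Continuous.integrable_toSphere {k : sphere (0 : E) 1 → ℝ} (hk : Continuous k) :
    Integrable k μ.toSphere :=
  hk.integrable_of_hasCompactSupport (HasCompactSupport.of_compactSpace k)

theorem integral_fderiv_apply_eq_zero {ψ : E → ℝ} (hψ : ContDiff ℝ 1 ψ)
    (hc : HasCompactSupport ψ) (u : E) : ∫ y, fderiv ℝ ψ y u ∂μ = 0 := by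
  have hd : Continuous fun y => fderiv ℝ ψ y u :=
    (hψ.continuous_fderiv one_ne_zero).clm_apply continuous_const
  have hi : Integrable (fun y => fderiv ℝ ψ y u) μ :=
    hd.integrable_of_hasCompactSupport (hc.fderiv_apply ℝ u)
  have := integral_mul_fderiv_eq_neg_fderiv_mul_of_integrable (μ := μ) (f := fun _ => (1 : ℝ))
    (g := ψ) (v := u) (by simp) (by simpa using hi)
    (by simpa using hψ.continuous.integrable_of_hasCompactSupport hc) (by fun_prop)
    (fun x _ => hψ.differentiable one_ne_zero x)
  simpa using this

variable [Nontrivial E]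

/-- Integration by parts on the sphere for the linear field `X ↦ ⟪v, X⟫ u` with `u ⊥ v`. -/
theorem integral_sphere_inner_mul_fderiv (hn : Module.finrank ℝ E = n + 1) {g : E → ℝ}
    (hg0 : ∀ r : ℝ, 0 < r → ∀ y, g (r • y) = g y) (hg : ∀ y ≠ 0, ContDiffAt ℝ 1 g y)
    {u v : E} (huv : inner ℝ u v = 0) :
    ∫ X : sphere (0 : E) 1, inner ℝ v (X : E) * fderiv ℝ g X u ∂μ.toSphere =
      (n + 1) * ∫ X : sphere (0 : E) 1, inner ℝ u (X : E) * inner ℝ v (X : E) * g X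
        ∂μ.toSphere := by
  obtain ⟨a, ha, ha1, ha3, hpos⟩ := exists_radial_cutoff
  have hac := hasCompactSupport_of_cutoff ha1 ha3
  have hc0 : HasCompactSupport fun r => a r ^ (0 + 1) * r ^ n :=
    (hac.comp_left (g := (· ^ (0 + 1))) (by simp)).mul_right
  have hne : ∀ X : sphere (0 : E) 1, (X : E) ≠ 0 := fun X => ne_zero_of_mem_unit_sphere X
  -- The `u`-derivative of `a(|y|) ⟪v, y⟫ g` integrates to zero over the whole space. In polar
  -- coordinates, `g` being 0-homogeneous and `⟪u, v⟫ = 0`, it splits into the two spherical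
  -- integrals with radial weights `a r^n` and `a' r^{n+1}`.
  let G : E → ℝ := fun y => inner ℝ v y * g y
  have hG : ∀ y ≠ 0, ContDiffAt ℝ 1 G y := fun y hy =>
    (contDiffAt_const.inner ℝ contDiffAt_id).mul (hg y hy)
  have ha' : ContDiff ℝ 1 a := ha.of_le (by exact_mod_cast le_top)
  have hψ : ContDiff ℝ 1 fun y => a ‖y‖ • G y := contDiff_radial_smul (k := 1) ha' ha1 hG
  have hψc : HasCompactSupport fun y => a ‖y‖ • G y := hasCompactSupport_radial_smul G ha3
  have hder : ∀ y ≠ 0, fderiv ℝ (fun y => a ‖y‖ • G y) y u =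
      a ‖y‖ * (inner ℝ v y * fderiv ℝ g y u)
        + deriv a ‖y‖ * ‖y‖⁻¹ * inner ℝ y u * (inner ℝ v y * g y) := fun y hy => by
    have h1 : HasFDerivAt G (inner ℝ v y • fderiv ℝ g y + g y • innerSL ℝ v) y :=
      (innerSL ℝ v).hasFDerivAt.mul ((hg y hy).differentiableAt one_ne_zero).hasFDerivAt
    rw [(hasFDerivAt_radial_smul hy (ha'.differentiable one_ne_zero _) h1).fderiv]
    simp [G, real_inner_comm u v, huv]
  have hda : Continuous (deriv a) := ha'.continuous_deriv le_rfl
  have hcX : Continuous fun X : sphere (0 : E) 1 => (X : E) := continuous_subtype_val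
  have hcg : Continuous fun X : sphere (0 : E) 1 => g X := continuous_iff_continuousAt.2 fun X =>
    (hg X (hne X)).continuousAt.comp hcX.continuousAt
  have hcdg : Continuous fun X : sphere (0 : E) 1 => fderiv ℝ g X u :=
    continuous_iff_continuousAt.2 fun X => by
      have h1 : ContinuousAt (fderiv ℝ g) X :=
        ((hg X (hne X)).fderiv_right (m := 0) (by simp)).continuousAt
      exact (h1.clm_apply continuousAt_const).comp hcX.continuousAt
  have hpolar := integral_eq_of_polar μ hn (Φ := fun y => fderiv ℝ (fun y => a ‖y‖ • G y) y u)
    (a := fun r => a r ^ (0 + 1) * r ^ n) (b := fun r => deriv a r * r ^ (n + 1))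
    (k := fun X => inner ℝ v (X : E) * fderiv ℝ g X u)
    (l := fun X => inner ℝ u (X : E) * inner ℝ v (X : E) * g X)
    (Continuous.integrable_of_hasCompactSupport (by fun_prop) hc0).integrableOn
    (Continuous.integrable_of_hasCompactSupport (by fun_prop) hac.deriv.mul_right).integrableOn
    (((continuous_const.inner hcX).mul hcdg).integrable_toSphere μ)
    ((((continuous_const.inner hcX).mul (continuous_const.inner hcX)).mul hcg).integrable_toSphere μ)
    (fun r X hr => by
      rw [hder _ (smul_ne_zero hr.ne' (hne X)), fderiv_smul_of_homogeneous_zero hg0 hr, hg0 r hr,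
        norm_smul, norm_eq_of_mem_sphere X, Real.norm_of_nonneg hr.le]
      simp only [inner_smul_right, inner_smul_left, _root_.smul_apply, smul_eq_mul,
        real_inner_comm u (X : E), mul_one, conj_trivial, zero_add, pow_one]
      field_simp
      ring)
  rw [integral_fderiv_apply_eq_zero μ hψ hψc] at hpolar
  -- Integrating `(a r^{n+1})'` over the half-line produces the factor `n + 1`.
  have hparts : (n + 1) * (∫ r in Ioi 0, a r ^ (0 + 1) * r ^ n)
      + ∫ r in Ioi 0, deriv a r * r ^ (n + 1) = 0 := by
    have h1 : ContDiff ℝ 1 fun r => a r * r ^ (n + 1) := ha'.mul (contDiff_id.pow _)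
    have h2 := HasCompactSupport.integral_Ioi_deriv_eq h1 hac.mul_right 0
    have h3 : ∀ r, deriv (fun r => a r * r ^ (n + 1)) r =
        (n + 1) * (a r ^ (0 + 1) * r ^ n) + deriv a r * r ^ (n + 1) := fun r => by
      have := ((ha'.differentiable one_ne_zero r).hasDerivAt.mul (hasDerivAt_pow (n + 1) r)).deriv
      rw [show (fun r => a r * r ^ (n + 1)) = a * fun r => r ^ (n + 1) from rfl, this]
      push_cast
      simp
      ring
    simp_rw [h3] at h2
    rw [integral_add, integral_const_mul] at h2
    · rw [h2]; simp
    · exact ((Continuous.integrable_of_hasCompactSupport (by fun_prop) hc0).const_mul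
        _).integrableOn
    · exact (Continuous.integrable_of_hasCompactSupport (by fun_prop)
        hac.deriv.mul_right).integrableOn
  have hI := hpos 0 n
  rw [eq_neg_of_add_eq_zero_right hparts] at hpolar
  refine mul_left_cancel₀ hI.ne' ?_
  linarith

end SphereIntegrals

/-! ### The gradient of a support function and its derivative. -/

section Support

variable {E : Type*} [NormedAddCommGroup E] [InnerProductSpace ℝ E] [FiniteDimensional ℝ E]

/-- The Riesz isomorphism from the dual of a finite dimensional Euclidean space. -/
noncomputable def rieszSharp : (E →L[ℝ] ℝ) →L[ℝ] E :=
  LinearMap.toContinuousLinearMap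
    { toFun := (InnerProductSpace.toDual ℝ E).symm
      map_add' := map_add _
      map_smul' := fun c φ => by simp }

theorem inner_rieszSharp (φ : E →L[ℝ] ℝ) (z : E) : inner ℝ (rieszSharp φ) z = φ z :=
  InnerProductSpace.toDual_symm_apply

/-- The gradient of the `1`-homogeneous function `y ↦ ‖y‖ g y`. For the radial extension `g` of a
support function on the sphere, this is the inverse of the Gauss map. -/
noncomputable def supportGradient (g : E → ℝ) (y : E) : E :=
  rieszSharp (fderiv ℝ (fun z => ‖z‖ * g z) y)

variable {g : E → ℝ}

theorem contDiffAt_supportGradient (hg : ∀ y ≠ 0, ContDiffAt ℝ 2 g y) {y : E} (hy : y ≠ 0) :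
    ContDiffAt ℝ 1 (supportGradient g) y := by
  have h : ContDiffAt ℝ 2 (fun z => ‖z‖ * g z) y := (contDiffAt_norm ℝ hy).mul (hg y hy)
  exact rieszSharp.contDiff.contDiffAt.comp y (h.fderiv_right (by norm_num))

theorem supportGradient_smul (hg0 : ∀ r : ℝ, 0 < r → ∀ y, g (r • y) = g y) (r : ℝ) (hr : 0 < r)
    (y : E) : supportGradient g (r • y) = supportGradient g y := by
  unfold supportGradient
  rw [fderiv_smul_of_homogeneous_one (fun s hs z => ?_) hr]
  rw [hg0 s hs, norm_smul, Real.norm_of_nonneg hs.le, smul_eq_mul, mul_assoc]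

theorem inner_supportGradient {X : E} (hX : ‖X‖ = 1) (hg : DifferentiableAt ℝ g X) (z : E) :
    inner ℝ (supportGradient g X) z = fderiv ℝ g X z + g X * inner ℝ X z := by
  have hX0 : X ≠ 0 := fun h => by simp [h] at hX
  rw [supportGradient, inner_rieszSharp, fderiv_norm_mul_apply hX0 hg, hX]
  simp

theorem inner_fderiv_supportGradient (hg : ∀ y ≠ 0, ContDiffAt ℝ 2 g y) {X : E} (hX : X ≠ 0)
    (v w : E) : inner ℝ (fderiv ℝ (supportGradient g) X v) w
      = fderiv ℝ (fderiv ℝ fun z => ‖z‖ * g z) X v w := by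
  have h : ContDiffAt ℝ 2 (fun z => ‖z‖ * g z) X := (contDiffAt_norm ℝ hX).mul (hg X hX)
  have h1 : DifferentiableAt ℝ (fderiv ℝ fun z => ‖z‖ * g z) X :=
    (h.fderiv_right (m := 1) (by norm_num)).differentiableAt one_ne_zero
  have h2 : HasFDerivAt (supportGradient g)
      (rieszSharp ∘L fderiv ℝ (fderiv ℝ fun z => ‖z‖ * g z) X) X :=
    rieszSharp.hasFDerivAt.comp X h1.hasFDerivAt
  rw [h2.fderiv, ContinuousLinearMap.comp_apply, inner_rieszSharp]

/-- Identifies the tangential Hessian of `|y| g` with `∇²h + h I`, the matrix in the equation. The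
first-derivative formula is differentiated with `w` fixed; the terms with `⟪X, v⟫` or `⟪X, w⟫` drop
out. -/
theorem inner_fderiv_supportGradient_tangent (hg : ∀ y ≠ 0, ContDiffAt ℝ 2 g y) {X : E}
    (hX : ‖X‖ = 1) {v w : E} (hv : inner ℝ X v = 0) (hw : inner ℝ X w = 0) :
    inner ℝ (fderiv ℝ (supportGradient g) X v) w
      = fderiv ℝ (fderiv ℝ g) X v w + g X * inner ℝ v w := by
  have hX0 : X ≠ 0 := fun h => by simp [h] at hX
  rw [inner_fderiv_supportGradient hg hX0]
  have h : ContDiffAt ℝ 2 (fun z => ‖z‖ * g z) X := (contDiffAt_norm ℝ hX0).mul (hg X hX0)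
  have h1 : DifferentiableAt ℝ (fderiv ℝ fun z => ‖z‖ * g z) X :=
    (h.fderiv_right (m := 1) (by norm_num)).differentiableAt one_ne_zero
  have hg1 : DifferentiableAt ℝ (fderiv ℝ g) X :=
    ((hg X hX0).fderiv_right (m := 1) (by norm_num)).differentiableAt one_ne_zero
  have hgX : DifferentiableAt ℝ g X := (hg X hX0).differentiableAt two_ne_zero
  have hN := hasFDerivAt_norm_of_ne_zero hX0
  have hN' : HasFDerivAt (fun z : E => ‖z‖⁻¹) (-(‖X‖ ^ 2)⁻¹ • (‖X‖⁻¹ • innerSL ℝ X)) X :=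
    (hasDerivAt_inv (norm_ne_zero_iff.2 hX0)).comp_hasFDerivAt X hN
  have hL : HasFDerivAt (fun y => fderiv ℝ (fun z => ‖z‖ * g z) y w)
      ((fderiv ℝ (fderiv ℝ fun z => ‖z‖ * g z) X).flip w) X := by
    have := h1.hasFDerivAt.clm_apply (hasFDerivAt_const w X)
    simpa using this
  have hgw : HasFDerivAt (fun y => fderiv ℝ g y w) ((fderiv ℝ (fderiv ℝ g) X).flip w) X := by
    have := hg1.hasFDerivAt.clm_apply (hasFDerivAt_const w X)
    simpa using this
  have hi : HasFDerivAt (fun y : E => inner ℝ y w) (innerSL ℝ w) X := by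
    have := (innerSL ℝ w).hasFDerivAt (x := X)
    simpa [real_inner_comm] using this
  have hR := (hN.mul hgw).add (hgX.hasFDerivAt.mul (hN'.mul hi))
  have heq : (fun y => fderiv ℝ (fun z => ‖z‖ * g z) y w) =ᶠ[nhds X]
      fun y => ‖y‖ * fderiv ℝ g y w + g y * (‖y‖⁻¹ * inner ℝ y w) := by
    filter_upwards [isOpen_ne.mem_nhds hX0] with y hy
    exact fderiv_norm_mul_apply hy ((hg y hy).differentiableAt two_ne_zero) w
  have := DFunLike.congr_fun (hL.unique (hR.congr_of_eventuallyEq heq)) v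
  simp only [ContinuousLinearMap.flip_apply] at this
  rw [this]
  simp [hX, hv, hw, real_inner_comm]

/-- The gradient is 0-homogeneous, so its derivative kills `X`; that derivative is a symmetric
Hessian, so its image is orthogonal to `X`. -/
theorem inner_self_fderiv_supportGradient (hg0 : ∀ r : ℝ, 0 < r → ∀ y, g (r • y) = g y)
    (hg : ∀ y ≠ 0, ContDiffAt ℝ 2 g y) {X : E} (hX : X ≠ 0) (v : E) :
    inner ℝ X (fderiv ℝ (supportGradient g) X v) = 0 := by
  have h : ContDiffAt ℝ 2 (fun z => ‖z‖ * g z) X := (contDiffAt_norm ℝ hX).mul (hg X hX)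
  rw [real_inner_comm, inner_fderiv_supportGradient hg hX,
    h.isSymmSndFDerivAt (by simp) v X, ← inner_fderiv_supportGradient hg hX,
    fderiv_self_of_homogeneous_zero (supportGradient_smul hg0)
      ((contDiffAt_supportGradient hg hX).differentiableAt one_ne_zero), inner_zero_left]

end Support

/-! ### Invariance of volume under shears, to first order. -/

section MixedVolume

open MeasureTheory Set Metric

variable {E : Type*} [NormedAddCommGroup E] [InnerProductSpace ℝ E] [FiniteDimensional ℝ E]
  {n : ℕ} {g : E → ℝ}

/-- The Jacobian of the sheared map separates into radial and spherical factors, as polar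
integration requires. -/
theorem det_fderiv_radial_shear (hn : Module.finrank ℝ E = n + 1)
    (hg0 : ∀ r : ℝ, 0 < r → ∀ y, g (r • y) = g y) (hg : ∀ y ≠ 0, ContDiffAt ℝ 2 g y)
    {u v : E} (huv : inner ℝ u v = 0) {a : ℝ → ℝ} (ha : Differentiable ℝ a) {X : E}
    (hX : ‖X‖ = 1) (e : OrthonormalBasis (Fin n) ℝ (ℝ ∙ X)ᗮ) {d : ℝ}
    (hd : (Matrix.of fun i j : Fin n => fderiv ℝ (fderiv ℝ g) X (e i) (e j)
      + g X * (1 : Matrix (Fin n) (Fin n) ℝ) i j).det = d) {r : ℝ} (hr : 0 < r) :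
    (fderiv ℝ (fun y => a ‖y‖ • (supportGradient g y
      + (‖y‖ * inner ℝ u (supportGradient g y)) • v)) (r • X)).det * r ^ n =
      a r ^ n * deriv a r * (d * inner ℝ X (supportGradient g X))
      + a r ^ (n + 1) * (d * (inner ℝ X v * inner ℝ u (supportGradient g X))) := by
  have hX0 : X ≠ 0 := fun h => by simp [h] at hX
  have hrX : r • X ≠ 0 := smul_ne_zero hr.ne' hX0
  set Y := supportGradient g with hY
  have hYd : DifferentiableAt ℝ Y (r • X) :=
    (contDiffAt_supportGradient hg hrX).differentiableAt one_ne_zero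
  set S := fderiv ℝ Y X with hS
  have hDY : HasFDerivAt Y (r⁻¹ • S) (r • X) := by
    have h := hYd.hasFDerivAt
    rwa [fderiv_smul_of_homogeneous_zero (supportGradient_smul hg0) hr] at h
  have hYr : Y (r • X) = Y X := supportGradient_smul hg0 r hr X
  have hnorm : ‖r • X‖ = r := by rw [norm_smul, hX, mul_one, Real.norm_of_nonneg hr.le]
  have hG : HasFDerivAt (fun y => Y y + (‖y‖ * inner ℝ u (Y y)) • v) _ (r • X) :=
    hDY.add (((hasFDerivAt_norm_of_ne_zero hrX).mul
      ((innerSL ℝ u).hasFDerivAt.comp (r • X) hDY)).smul_const v)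
  have hΘ := hasFDerivAt_radial_smul hrX (ha ‖r • X‖) hG
  obtain ⟨T, hΘT, hTz⟩ : ∃ T : E →L[ℝ] E, HasFDerivAt (fun y => a ‖y‖ • (Y y
      + (‖y‖ * inner ℝ u (Y y)) • v)) T (r • X) ∧ ∀ z, T z =
        a r • (r⁻¹ • S z + (r * (r⁻¹ * inner ℝ u (S z)) + inner ℝ u (Y X) * inner ℝ X z) • v)
        + (deriv a r * inner ℝ X z) • (Y X + (r * inner ℝ u (Y X)) • v) :=
    ⟨_, hΘ, fun z => by
      simp [hnorm, hYr, hr.ne', mul_assoc]⟩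
  rw [hΘT.fderiv]
  -- The derivative factors as the shear `1 + r v ⊗ u`, of determinant one because `u ⊥ v`, after
  -- `(a / r) S + ⟪X, ·⟫ w`. The `v` term of `w` comes from differentiating the shear parameter
  -- `|y|`.
  let w : E := deriv a r • Y X + (a r * inner ℝ u (Y X)) • v
  let T₀ : E →ₗ[ℝ] E := (a r / r) • (S : E →ₗ[ℝ] E) + (innerₗ E X).smulRight w
  have hfac : (T : E →ₗ[ℝ] E) = LinearMap.transvection (r • innerₗ E u) v ∘ₗ T₀ := by
    ext z
    have hT₀z : T₀ z = (a r / r) • S z + inner ℝ X z • w := by simp [T₀]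
    change T z = T₀ z + (r • innerₗ E u) (T₀ z) • v
    have hu : (r • innerₗ E u) (T₀ z) = r * (a r / r * inner ℝ u (S z)
        + inner ℝ X z * (deriv a r * inner ℝ u (Y X))) := by
      rw [hT₀z]
      simp [w, inner_add_right, inner_smul_right, huv]
    rw [hu, hTz, hT₀z]
    simp only [w]
    have hr0 := hr.ne'
    match_scalars <;> field_simp
    ring
  have hSX : S X = 0 := fderiv_self_of_homogeneous_zero (supportGradient_smul hg0)
    ((contDiffAt_supportGradient hg hX0).differentiableAt one_ne_zero)
  have hdet₀ := det_smul_add_inner_smul hn hX e (S := S) (T := T₀) hSX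
    (fun z => inner_self_fderiv_supportGradient hg0 hg hX0 z) (a r / r) w
    (fun z => by simp [T₀])
  have hmat : (Matrix.of fun i j : Fin n => inner ℝ (e i : E) ((S : E →ₗ[ℝ] E) (e j))).det = d := by
    rw [← hd, ← Matrix.det_transpose]
    congr 1
    ext i j
    have heX : ∀ i, inner ℝ X (e i : E) = 0 := fun i =>
      Submodule.mem_orthogonal_singleton_iff_inner_right.1 (e i).2
    have hij := orthonormal_iff_ite.1 e.orthonormal i j
    rw [Submodule.coe_inner] at hij
    simp only [Matrix.transpose_apply, Matrix.of_apply, ContinuousLinearMap.coe_coe]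
    rw [real_inner_comm, inner_fderiv_supportGradient_tangent hg hX (heX i) (heX j), hij,
      Matrix.one_apply]
  rw [ContinuousLinearMap.det, hfac, LinearMap.det_comp, LinearMap.transvection.det, hdet₀, hmat]
  simp only [w, inner_add_right, inner_smul_right, LinearMap.smul_apply, innerₗ_apply_apply, huv]
  have hr0 := hr.ne'
  rw [div_pow]
  simp only [smul_zero, add_zero]
  field_simp
  ring

variable [Nontrivial E] [MeasurableSpace E] [BorelSpace E] (μ : Measure E) [μ.IsAddHaarMeasure]

/-- The surface area measure of a support function is orthogonal to the infinitesimal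
action of volume preserving linear maps. -/
theorem integral_det_mul_inner_supportGradient (hn : Module.finrank ℝ E = n + 1)
    (hg0 : ∀ r : ℝ, 0 < r → ∀ y, g (r • y) = g y) (hg : ∀ y ≠ 0, ContDiffAt ℝ 2 g y)
    {u v : E} (huv : inner ℝ u v = 0) {d : sphere (0 : E) 1 → ℝ} (hd : Continuous d)
    (hdet : ∀ X : sphere (0 : E) 1, ∃ e : OrthonormalBasis (Fin n) ℝ (ℝ ∙ (X : E))ᗮ,
      (Matrix.of fun i j : Fin n => fderiv ℝ (fderiv ℝ g) X (e i) (e j)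
        + g X * (1 : Matrix (Fin n) (Fin n) ℝ) i j).det = d X) :
    ∫ X, d X * (inner ℝ (X : E) v * inner ℝ u (supportGradient g X)) ∂μ.toSphere = 0 := by
  obtain ⟨a, ha, ha1, ha3, hpos⟩ := exists_radial_cutoff
  have hac := hasCompactSupport_of_cutoff ha1 ha3
  have ha' : ContDiff ℝ 1 a := ha.of_le (by exact_mod_cast le_top)
  have had : Differentiable ℝ a := ha'.differentiable one_ne_zero
  have hda : Continuous (deriv a) := ha'.continuous_deriv le_rfl
  have hY : ∀ y ≠ 0, ContDiffAt ℝ 1 (supportGradient g) y := fun y hy =>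
    contDiffAt_supportGradient hg hy
  -- The factor `‖y‖` is essential: a constant shear would leave the Jacobian unchanged and give no
  -- information.
  let G : E → E := fun y => supportGradient g y + (‖y‖ * inner ℝ u (supportGradient g y)) • v
  have hG : ∀ y ≠ 0, ContDiffAt ℝ 1 G y := fun y hy =>
    (hY y hy).add (((contDiffAt_norm ℝ hy).mul (contDiffAt_const.inner ℝ (hY y hy))).smul
      contDiffAt_const)
  have hzero := integral_det_fderiv_eq_zero μ (contDiff_radial_smul (k := 1) ha' ha1 hG)
    (hasCompactSupport_radial_smul G ha3)
  have hcX : Continuous fun X : sphere (0 : E) 1 => (X : E) := continuous_subtype_val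
  have hcY : Continuous fun X : sphere (0 : E) 1 => supportGradient g X :=
    continuous_iff_continuousAt.2 fun X =>
      (hY X (ne_zero_of_mem_unit_sphere X)).continuousAt.comp hcX.continuousAt
  have hca := ha'.continuous
  have hc1 : HasCompactSupport fun r => a r ^ n * deriv a r := hac.deriv.mul_left
  have hc2 : HasCompactSupport fun r => a r ^ (n + 1) :=
    hac.comp_left (g := (· ^ (n + 1))) (by simp)
  have hpolar := integral_eq_of_polar μ hn
    (Φ := fun y => (fderiv ℝ (fun y => a ‖y‖ • G y) y).det) (a := fun r => a r ^ n * deriv a r)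
    (b := fun r => a r ^ (n + 1))
    (k := fun X => d X * inner ℝ (X : E) (supportGradient g X))
    (l := fun X => d X * (inner ℝ (X : E) v * inner ℝ u (supportGradient g X)))
    (Continuous.integrable_of_hasCompactSupport (by fun_prop) hc1).integrableOn
    (Continuous.integrable_of_hasCompactSupport (by fun_prop) hc2).integrableOn
    ((hd.mul (hcX.inner hcY)).integrable_toSphere μ)
    ((hd.mul ((hcX.inner continuous_const).mul (continuous_const.inner hcY))).integrable_toSphere μ)
    (fun r X hr => by
      obtain ⟨e, he⟩ := hdet X
      exact det_fderiv_radial_shear hn hg0 hg huv had (norm_eq_of_mem_sphere X) e he hr)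
  rw [hzero] at hpolar
  -- The weight is a multiple of `(a^{n+1})'`, so the volume term disappears and only the shear term
  -- survives.
  have hparts : ∫ r in Ioi 0, a r ^ n * deriv a r = 0 := by
    have h1 : ContDiff ℝ 1 fun r => a r ^ (n + 1) := ha'.pow _
    have h2 := HasCompactSupport.integral_Ioi_deriv_eq h1 hc2 0
    have h3 : ∀ r, deriv (fun r => a r ^ (n + 1)) r = (n + 1) * (a r ^ n * deriv a r) :=
      fun r => by
        rw [((had r).hasDerivAt.fun_pow (n + 1)).deriv]
        push_cast
        ring
    simp_rw [h3] at h2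
    rw [integral_const_mul, ha1 0 zero_le_one, zero_pow n.succ_ne_zero, neg_zero] at h2
    exact (mul_eq_zero.1 h2).resolve_left (by positivity)
  have hI := hpos n 0
  simp only [pow_zero, mul_one] at hI
  rw [hparts, zero_mul, zero_add] at hpolar
  exact (mul_eq_zero.1 hpolar.symm).resolve_left hI.ne'

end MixedVolume

/-! ### The identity for trace-free linear fields. -/

namespace LpMinkowski

open MeasureTheory

variable {n : ℕ} {p : ℝ} {f h : Sph n → ℝ}

theorem continuous_fderiv_radialExt (hf : ContMDiff (𝓡 n) 𝓘(ℝ) 1 f) :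
    Continuous fun X : Sph n => fderiv ℝ (radialExt f) (X : EuclideanSpace ℝ (Fin (n + 1))) :=
  continuous_iff_continuousAt.2 fun X =>
    ((contDiffAt_radialExt (k := 1) hf (ne_zero_of_mem_unit_sphere X)).fderiv_right
      (m := 0) (by simp)).continuousAt.comp continuous_subtype_val.continuousAt

theorem IsSolution.continuous_rpow (hh : IsSolution n p f h) (q : ℝ) :
    Continuous fun X => h X ^ q :=
  hh.contMDiff.continuous.rpow_const fun X => Or.inl (hh.pos X).ne'

theorem IsSolution.radialExt_pos (hh : IsSolution n p f h)
    {y : EuclideanSpace ℝ (Fin (n + 1))} (hy : y ≠ 0) : 0 < radialExt h y := by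
  rw [radialExt, dif_neg hy]
  exact hh.pos _

/-- The integrand of the Pohozaev type identity for the linear field `X ↦ ⟪v, X⟫ u`. -/
noncomputable def pohozaevIntegrand (p : ℝ) (f h : Sph n → ℝ)
    (u v : EuclideanSpace ℝ (Fin (n + 1))) (X : Sph n) : ℝ :=
  (inner ℝ v (X : EuclideanSpace ℝ (Fin (n + 1))) * dirDeriv f X u
    - (p + n + 1) * (inner ℝ u (X : EuclideanSpace ℝ (Fin (n + 1)))
      * inner ℝ v (X : EuclideanSpace ℝ (Fin (n + 1)))) * f X) * h X ^ p

theorem IsSolution.continuous_pohozaevIntegrand (hf : ContMDiff (𝓡 n) 𝓘(ℝ) 1 f)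
    (hh : IsSolution n p f h) (u v : EuclideanSpace ℝ (Fin (n + 1))) :
    Continuous (pohozaevIntegrand p f h u v) := by
  have h1 := (continuous_fderiv_radialExt hf).clm_apply (continuous_const (y := u))
  have h2 := hh.continuous_rpow p
  have h3 := hf.continuous
  unfold pohozaevIntegrand dirDeriv
  fun_prop

theorem IsSolution.integral_pohozaevIntegrand_of_inner_eq_zero (hf : ContMDiff (𝓡 n) 𝓘(ℝ) 1 f)
    (hh : IsSolution n p f h) {u v : EuclideanSpace ℝ (Fin (n + 1))} (huv : inner ℝ u v = 0) :
    ∫ X, pohozaevIntegrand p f h u v X ∂(surfaceMeasure n) = 0 := by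
  have hn : Module.finrank ℝ (EuclideanSpace ℝ (Fin (n + 1))) = n + 1 := finrank_euclideanSpace_fin
  have hfact : Fact (Module.finrank ℝ (EuclideanSpace ℝ (Fin (n + 1))) = n + 1) := ⟨hn⟩
  have hne : ∀ X : Sph n, (X : EuclideanSpace ℝ (Fin (n + 1))) ≠ 0 := fun X =>
    ne_zero_of_mem_unit_sphere X
  have hf1 : ∀ y ≠ 0, ContDiffAt ℝ 1 (radialExt f) y := fun y hy =>
    contDiffAt_radialExt (k := 1) hf hy
  have hh2 : ∀ y ≠ 0, ContDiffAt ℝ 2 (radialExt h) y := fun y hy =>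
    contDiffAt_radialExt (k := 2) hh.contMDiff hy
  have hh0 : ∀ r : ℝ, 0 < r → ∀ y, radialExt h (r • y) = radialExt h y := fun r hr y =>
    radialExt_smul h hr y
  let g : EuclideanSpace ℝ (Fin (n + 1)) → ℝ := fun y => radialExt f y * radialExt h y ^ p
  have hg0 : ∀ r : ℝ, 0 < r → ∀ y, g (r • y) = g y := fun r hr y => by
    simp only [g, radialExt_smul _ hr]
  have hg1 : ∀ y ≠ 0, ContDiffAt ℝ 1 g y := fun y hy =>
    (hf1 y hy).mul (((hh2 y hy).of_le one_le_two).rpow_const_of_ne (hh.radialExt_pos hy).ne')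
  have hparts := integral_sphere_inner_mul_fderiv volume hn hg0 hg1 huv
  have hsol := integral_det_mul_inner_supportGradient volume hn hh0 hh2 huv
    (d := fun X => f X * h X ^ (p - 1)) (hf.continuous.mul (hh.continuous_rpow _)) fun X => by
      let e := OrthonormalBasis.fromOrthogonalSpanSingleton (𝕜 := ℝ) n (hne X)
      refine ⟨e, ?_⟩
      rw [← hh.eqn X e, radialExt_coe]
      rfl
  have hcX : Continuous fun X : Sph n => (X : EuclideanSpace ℝ (Fin (n + 1))) :=
    continuous_subtype_val
  have hcg : Continuous fun X : Sph n => g X := continuous_iff_continuousAt.2 fun X =>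
    (hg1 X (hne X)).continuousAt.comp hcX.continuousAt
  have hcdg : Continuous fun X : Sph n => fderiv ℝ g X u :=
    continuous_iff_continuousAt.2 fun X => by
      have h1 : ContinuousAt (fderiv ℝ g) X :=
        ((hg1 X (hne X)).fderiv_right (m := 0) (by simp)).continuousAt
      exact (h1.clm_apply continuousAt_const).comp hcX.continuousAt
  have hcY : Continuous fun X : Sph n => supportGradient (radialExt h) X :=
    continuous_iff_continuousAt.2 fun X =>
      (contDiffAt_supportGradient hh2 (hne X)).continuousAt.comp hcX.continuousAt
  have hdg : ∀ X : Sph n, fderiv ℝ g X u = f X * (p * h X ^ (p - 1) * fderiv ℝ (radialExt h) X u)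
      + h X ^ p * fderiv ℝ (radialExt f) X u := fun X => by
    have h1 := ((hf1 X (hne X)).differentiableAt one_ne_zero).hasFDerivAt
    have h2 := ((hh2 X (hne X)).differentiableAt two_ne_zero).hasFDerivAt.rpow_const
      (p := p) (Or.inl (hh.radialExt_pos (hne X)).ne')
    have h3 : HasFDerivAt g _ X := h1.mul h2
    rw [h3.fderiv]
    simp [radialExt_coe]
  have hY : ∀ X : Sph n, inner ℝ u (supportGradient (radialExt h) X) =
      fderiv ℝ (radialExt h) X u + h X * inner ℝ u (X : EuclideanSpace ℝ (Fin (n + 1))) :=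
    fun X => by
      rw [real_inner_comm, inner_supportGradient (norm_eq_of_mem_sphere X)
        ((hh2 X (hne X)).differentiableAt two_ne_zero), radialExt_coe, real_inner_comm u]
  -- Writing `∂_u h = ⟪u, Y⟫ - h ⟪u, X⟫` turns the coefficient `p + n + 1` into `n + 1`, which
  -- integration by parts cancels, plus a multiple of the shear integrand.
  have hpt : ∀ X, pohozaevIntegrand p f h u v X =
      (inner ℝ v (X : EuclideanSpace ℝ (Fin (n + 1))) * fderiv ℝ g X u
        - (n + 1) * (inner ℝ u (X : EuclideanSpace ℝ (Fin (n + 1)))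
          * inner ℝ v (X : EuclideanSpace ℝ (Fin (n + 1))) * g X))
      - p * (f X * h X ^ (p - 1) * (inner ℝ (X : EuclideanSpace ℝ (Fin (n + 1))) v
          * inner ℝ u (supportGradient (radialExt h) X))) := fun X => by
    have hpow : h X ^ p = h X ^ (p - 1) * h X := by
      rw [← Real.rpow_add_one (hh.pos X).ne', sub_add_cancel]
    rw [hdg, hY, real_inner_comm v]
    simp only [pohozaevIntegrand, dirDeriv, g, radialExt_coe, hpow]
    ring
  simp_rw [hpt]
  have hi1 : Integrable (fun X : Sph n => inner ℝ v (X : EuclideanSpace ℝ (Fin (n + 1)))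
      * fderiv ℝ g X u) (surfaceMeasure n) :=
    Continuous.integrable_toSphere volume (by fun_prop)
  have hi2 : Integrable (fun X : Sph n => (n + 1) * (inner ℝ u (X : EuclideanSpace ℝ (Fin (n + 1)))
      * inner ℝ v (X : EuclideanSpace ℝ (Fin (n + 1))) * g X)) (surfaceMeasure n) :=
    (Continuous.integrable_toSphere volume
      (((continuous_const.inner hcX).mul (continuous_const.inner hcX)).mul hcg)).const_mul _
  have hi3 : Integrable (fun X : Sph n => p * (f X * h X ^ (p - 1)
      * (inner ℝ (X : EuclideanSpace ℝ (Fin (n + 1))) v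
        * inner ℝ u (supportGradient (radialExt h) X)))) (surfaceMeasure n) :=
    (Continuous.integrable_toSphere volume ((hf.continuous.mul (hh.continuous_rpow (p - 1))).mul
      ((hcX.inner continuous_const).mul (continuous_const.inner hcY)))).const_mul _
  have hi12 : Integrable (fun X : Sph n => inner ℝ v (X : EuclideanSpace ℝ (Fin (n + 1)))
      * fderiv ℝ g X u - (n + 1) * (inner ℝ u (X : EuclideanSpace ℝ (Fin (n + 1)))
      * inner ℝ v (X : EuclideanSpace ℝ (Fin (n + 1))) * g X)) (surfaceMeasure n) := hi1.sub hi2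
  rw [integral_sub hi12 hi3, integral_sub hi1 hi2, integral_const_mul, integral_const_mul,
    surfaceMeasure, hparts, hsol]
  ring

/-- By linearity in `M`: off-diagonal matrix units contribute zero and all diagonal ones contribute
equally, so the integral is a multiple of the trace. -/
theorem IsSolution.integral_trace_zero (hf : ContMDiff (𝓡 n) 𝓘(ℝ) 1 f)
    (hh : IsSolution n p f h) {M : Matrix (Fin (n + 1)) (Fin (n + 1)) ℝ} (hM : M.trace = 0) :
    ∫ X : Sph n, (dirDeriv f X (M.toEuclideanLin X)
      - (p + n + 1) * inner ℝ (X : EuclideanSpace ℝ (Fin (n + 1))) (M.toEuclideanLin X) * f X)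
        * h X ^ p ∂(surfaceMeasure n) = 0 := by
  let b := EuclideanSpace.basisFun (Fin (n + 1)) ℝ
  let K : Fin (n + 1) → Fin (n + 1) → Sph n → ℝ := fun i j => pohozaevIntegrand p f h (b i) (b j)
  have hint : ∀ i j, Integrable (K i j) (surfaceMeasure n) := fun i j =>
    (hh.continuous_pohozaevIntegrand hf _ _).integrable_toSphere volume
  have hoff : ∀ i j, i ≠ j → ∫ X, K i j X ∂(surfaceMeasure n) = 0 := fun i j hij =>
    hh.integral_pohozaevIntegrand_of_inner_eq_zero hf (b.inner_eq_zero hij)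
  have hdiag : ∀ i j, ∫ X, K i i X ∂(surfaceMeasure n) = ∫ X, K j j X ∂(surfaceMeasure n) := by
    intro i j
    rcases eq_or_ne i j with rfl | hij
    · rfl
    -- This orthogonal pair yields the difference of two diagonal units, up to off-diagonal ones.
    have hperp : inner ℝ (b i + b j) (b i - b j) = 0 := by
      rw [inner_add_left, inner_sub_right, inner_sub_right, b.inner_eq_one, b.inner_eq_one,
        b.inner_eq_zero hij, b.inner_eq_zero hij.symm]
      ring
    have h0 := hh.integral_pohozaevIntegrand_of_inner_eq_zero hf hperp
    have hexp : ∀ X, pohozaevIntegrand p f h (b i + b j) (b i - b j) X =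
        (K i i X - K j j X) + (K j i X - K i j X) := fun X => by
      simp only [K, pohozaevIntegrand, dirDeriv, map_add, inner_add_left, inner_sub_left]
      ring
    simp_rw [hexp] at h0
    have hsub : ∀ i j k l, Integrable (fun X => K i j X - K k l X) (surfaceMeasure n) :=
      fun i j k l => (hint i j).sub (hint k l)
    rw [integral_add (hsub i i j j) (hsub j i i j), integral_sub (hint i i) (hint j j), integral_sub (hint j i) (hint i j), hoff i j hij,
      hoff j i hij.symm] at h0
    linarith
  have hpt : ∀ X : Sph n, (dirDeriv f X (M.toEuclideanLin X)
      - (p + n + 1) * inner ℝ (X : EuclideanSpace ℝ (Fin (n + 1))) (M.toEuclideanLin X) * f X)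
        * h X ^ p = ∑ i, ∑ j, M i j * K i j X := fun X => by
    have hMX : M.toEuclideanLin (X : EuclideanSpace ℝ (Fin (n + 1))) =
        ∑ i, ∑ j, (M i j * inner ℝ (b j) (X : EuclideanSpace ℝ (Fin (n + 1)))) • b i := by
      simp_rw [← Finset.sum_smul]
      rw [← b.sum_repr (M.toEuclideanLin (X : EuclideanSpace ℝ (Fin (n + 1))))]
      refine Finset.sum_congr rfl fun i _ => ?_
      congr 1
      simp [b, Matrix.toLpLin_apply, Matrix.mulVec, dotProduct, EuclideanSpace.inner_single_left]
    rw [hMX]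
    simp only [dirDeriv, map_sum, map_smul, inner_sum, inner_smul_right, smul_eq_mul,
      Finset.mul_sum, Finset.sum_mul, ← Finset.sum_sub_distrib]
    refine Finset.sum_congr rfl fun i _ => Finset.sum_congr rfl fun j _ => ?_
    simp only [K, pohozaevIntegrand, dirDeriv,
      real_inner_comm (b i) (X : EuclideanSpace ℝ (Fin (n + 1)))]
    ring
  simp_rw [hpt]
  have hterm : ∀ i j, Integrable (fun X => M i j * K i j X) (surfaceMeasure n) := fun i j =>
    (hint i j).const_mul (M i j)
  rw [integral_finsetSum (f := fun i X => ∑ j, M i j * K i j X) _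
    fun i _ => integrable_finsetSum _ fun j _ => hterm i j]
  have hrow : ∀ i, ∫ X, ∑ j, M i j * K i j X ∂(surfaceMeasure n)
      = M i i * ∫ X, K 0 0 X ∂(surfaceMeasure n) := fun i => by
    rw [integral_finsetSum (f := fun j X => M i j * K i j X) _ fun j _ => hterm i j, Finset.sum_eq_single i]
    · rw [integral_const_mul, hdiag i 0]
    · intro j _ hj
      rw [integral_const_mul, hoff i j hj.symm, mul_zero]
    · simp
  rw [Finset.sum_congr rfl fun i _ => hrow i, ← Finset.sum_mul]
  change M.trace * _ = 0
  rw [hM, zero_mul]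

end LpMinkowski

/-! ### The projective field as the tangential part of a linear field. -/

namespace LpMinkowski

variable {n : ℕ}

theorem inner_pair (x y : EuclideanSpace ℝ (Fin n)) (s t : ℝ) :
    inner ℝ (pair x s) (pair y t) = inner ℝ x y + s * t := by
  simp [pair, PiLp.inner_apply, Fin.sum_univ_castSucc, mul_comm]

theorem smul_pair (c : ℝ) (x : EuclideanSpace ℝ (Fin n)) (t : ℝ) :
    c • pair x t = pair (c • x) (c * t) := by
  ext i
  refine Fin.lastCases ?_ (fun j => ?_) i <;> simp [pair]

theorem pair_sub_pair (x y : EuclideanSpace ℝ (Fin n)) (s t : ℝ) :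
    pair x s - pair y t = pair (x - y) (s - t) := by
  ext i
  refine Fin.lastCases ?_ (fun j => ?_) i <;> simp [pair]

/-- The trace free matrix of the linear vector field on `ℝ^{n+1}` whose tangential part on the
sphere is the projective vector field. -/
noncomputable def projMatrix (A : Matrix (Fin n) (Fin n) ℝ) (B C : EuclideanSpace ℝ (Fin n))
    (D : ℝ) : Matrix (Fin (n + 1)) (Fin (n + 1)) ℝ :=
  -- In blocks, `A - D/(n+1)` and `B` above, `Cᵀ` and `nD/(n+1)` below. Scalar matrices have no
  -- tangential part, so only the difference `D` of the scalar parts matters for the field; this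
  -- splitting makes the trace vanish when `tr A = 0`.
  Matrix.of fun i j =>
    Fin.lastCases (motive := fun _ => ℝ)
      (Fin.lastCases (motive := fun _ => ℝ) (n * D / (n + 1)) (fun k => C k) j)
      (fun i' => Fin.lastCases (motive := fun _ => ℝ) (B i')
        (fun j' => A i' j' - (D / (n + 1)) * (1 : Matrix (Fin n) (Fin n) ℝ) i' j') j) i

variable (A : Matrix (Fin n) (Fin n) ℝ) (B C : EuclideanSpace ℝ (Fin n)) (D : ℝ)

theorem trace_projMatrix (hA : A.trace = 0) : (projMatrix A B C D).trace = 0 := by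
  have h : ∑ i, A i i = 0 := hA
  simp [Matrix.trace, Fin.sum_univ_castSucc, projMatrix, h]
  ring

theorem projMatrix_pair (x : EuclideanSpace ℝ (Fin n)) (t : ℝ) :
    (projMatrix A B C D).toEuclideanLin (pair x t) =
      pair (A.toEuclideanLin x - (D / (n + 1)) • x + t • B)
        (inner ℝ C x + n * D / (n + 1) * t) := by
  ext i
  refine Fin.lastCases ?_ (fun j => ?_) i
  · simp [pair, Matrix.toLpLin_apply, Matrix.mulVec, dotProduct, Fin.sum_univ_castSucc, projMatrix,
      PiLp.inner_apply, mul_comm]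
  · simp [pair, Matrix.toLpLin_apply, Matrix.mulVec, dotProduct, Fin.sum_univ_castSucc, projMatrix,
      sub_mul, Finset.sum_sub_distrib, Matrix.one_apply, mul_comm]

theorem inner_affField (x : EuclideanSpace ℝ (Fin n)) :
    inner ℝ x (affField A B C D x) = inner ℝ C x * ‖x‖ ^ 2 + inner ℝ x (A.toEuclideanLin x)
      - D * ‖x‖ ^ 2 - inner ℝ B x := by
  simp only [affField, inner_sub_right, inner_add_right, inner_smul_right,
    real_inner_self_eq_norm_sq, real_inner_comm B x]
  ring

theorem divergence_affField (hA : A.trace = 0) (x : EuclideanSpace ℝ (Fin n)) :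
    divergence (affField A B C D) x = (n + 1) * inner ℝ C x - n * D := by
  have hk : ∀ k : Fin n, fderiv ℝ (fun y => affField A B C D y k) x (EuclideanSpace.single k 1)
      = C k * x k + inner ℝ C x + A k k - D := fun k => by
    have hc : HasFDerivAt (fun y : EuclideanSpace ℝ (Fin n) => y k)
        (EuclideanSpace.proj k : EuclideanSpace ℝ (Fin n) →L[ℝ] ℝ) x :=
      (EuclideanSpace.proj k : EuclideanSpace ℝ (Fin n) →L[ℝ] ℝ).hasFDerivAt
    have hAk : HasFDerivAt (fun y : EuclideanSpace ℝ (Fin n) => A.toEuclideanLin y k)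
        ((EuclideanSpace.proj k : EuclideanSpace ℝ (Fin n) →L[ℝ] ℝ) ∘L
          A.toEuclideanLin.toContinuousLinearMap) x :=
      ((EuclideanSpace.proj k : EuclideanSpace ℝ (Fin n) →L[ℝ] ℝ) ∘L
          A.toEuclideanLin.toContinuousLinearMap).hasFDerivAt
    have h : HasFDerivAt (fun y => affField A B C D y k) _ x :=
      (((innerSL ℝ C).hasFDerivAt.mul hc).add (hAk.sub (hc.const_mul D))).sub_const (B k)
    rw [h.fderiv]
    simp [Matrix.toLpLin_apply, EuclideanSpace.inner_single_right]
    ring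
  have h : ∑ i, A i i = 0 := hA
  have hCx : ∑ k, C k * x k = inner ℝ C x := by simp [PiLp.inner_apply, mul_comm]
  rw [divergence, Finset.sum_congr rfl fun k _ => hk k]
  simp only [Finset.sum_sub_distrib, Finset.sum_add_distrib, h, hCx, Finset.sum_const,
    Finset.card_univ, Fintype.card_fin, nsmul_eq_mul]
  ring

theorem betaFun_affField (hA : A.trace = 0) (p : ℝ) (x : EuclideanSpace ℝ (Fin n)) :
    betaFun p (affField A B C D) x = betaExplicit p A B C D x := by
  rw [betaFun, betaExplicit, divergence_affField A B C D hA, inner_affField]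
  have h1 : (1 : ℝ) + ‖x‖ ^ 2 ≠ 0 := by positivity
  have h2 : (n : ℝ) + 1 ≠ 0 := by positivity
  field_simp
  ring

/-- The projective vector field on the sphere. -/
noncomputable def projField (X : Sph n) : EuclideanSpace ℝ (Fin (n + 1)) :=
  (projMatrix A B C D).toEuclideanLin X
    - inner ℝ (X : EuclideanSpace ℝ (Fin (n + 1))) ((projMatrix A B C D).toEuclideanLin X) • (X : _)

/-- The zeroth order companion of the projective vector field. -/
noncomputable def projBeta (p : ℝ) (X : Sph n) : ℝ :=
  -(p + n + 1) *
    inner ℝ (X : EuclideanSpace ℝ (Fin (n + 1))) ((projMatrix A B C D).toEuclideanLin X)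

theorem intUnit_mul_self (ε : ℤˣ) : (((ε : ℤ) : ℝ)) * ((ε : ℤ) : ℝ) = 1 := by
  rcases Int.units_eq_one_or ε with h | h <;> simp [h]

/-- When `tr A = 0`, the last two terms are `-σ_ε`; multiplying by `-(p + n + 1)` then gives the
defining formula for `β`. -/
theorem inner_projMatrix_proj (ε : ℤˣ) (x : EuclideanSpace ℝ (Fin n)) :
    inner ℝ (proj ε x : EuclideanSpace ℝ (Fin (n + 1)))
      ((projMatrix A B C D).toEuclideanLin (proj ε x)) =
    inner ℝ x (affField A (-((ε : ℤ) : ℝ) • B) (-((ε : ℤ) : ℝ) • C) D x) / (1 + ‖x‖ ^ 2)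
      + ((ε : ℤ) : ℝ) * inner ℝ C x + n * D / (n + 1) := by
  have hε := intUnit_mul_self ε
  have hw : √(1 + ‖x‖ ^ 2) ^ 2 = 1 + ‖x‖ ^ 2 := Real.sq_sqrt (by positivity)
  have hw0 : √(1 + ‖x‖ ^ 2) ≠ 0 := (Real.sqrt_pos.2 (by positivity)).ne'
  have h0 : (1 : ℝ) + ‖x‖ ^ 2 ≠ 0 := by positivity
  simp only [proj, map_smul, inner_smul_left, inner_smul_right, projMatrix_pair, inner_pair,
    inner_affField, inner_add_right, inner_sub_right, real_inner_self_eq_norm_sq, conj_trivial,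
    real_inner_comm B x]
  generalize ((ε : ℤ) : ℝ) = s at hε ⊢
  rw [← mul_assoc, ← mul_inv, ← sq, hw]
  field_simp
  linear_combination (n * D) * hε

theorem projField_proj (ε : ℤˣ) (x : EuclideanSpace ℝ (Fin n)) :
    projField A B C D (proj ε x) =
      pushVec ε x (affField A (-((ε : ℤ) : ℝ) • B) (-((ε : ℤ) : ℝ) • C) D x) := by
  have hε := intUnit_mul_self ε
  have hw : √(1 + ‖x‖ ^ 2) ^ 2 = 1 + ‖x‖ ^ 2 := Real.sq_sqrt (by positivity)
  have hw0 : √(1 + ‖x‖ ^ 2) ≠ 0 := (Real.sqrt_pos.2 (by positivity)).ne'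
  have hn : (n : ℝ) + 1 ≠ 0 := by positivity
  rw [projField, inner_projMatrix_proj]
  simp only [proj, map_smul, projMatrix_pair]
  simp only [smul_pair, pair_sub_pair, pushVec]
  generalize inner ℝ x (affField A _ _ D x) = J
  generalize √(1 + ‖x‖ ^ 2) = w at hw hw0 ⊢
  rw [← hw]
  simp only [affField, inner_smul_left, conj_trivial]
  generalize ((ε : ℤ) : ℝ) = s at hε ⊢
  congr 1
  · match_scalars <;> field_simp
    ring
  · field_simp
    linear_combination (-(n + 1) * w ^ 2 * inner ℝ C x) * hε

theorem projBeta_proj (hA : A.trace = 0) (p : ℝ) (ε : ℤˣ) (x : EuclideanSpace ℝ (Fin n)) :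
    projBeta A B C D p (proj ε x) =
      betaFun p (affField A (-((ε : ℤ) : ℝ) • B) (-((ε : ℤ) : ℝ) • C) D) x := by
  rw [projBeta, inner_projMatrix_proj, betaFun, divergence_affField _ _ _ _ hA, inner_smul_left,
    conj_trivial]
  have h2 : (n : ℝ) + 1 ≠ 0 := by positivity
  field_simp
  ring

theorem continuous_projField : Continuous (projField A B C D) := by
  have h : Continuous fun X : Sph n => (projMatrix A B C D).toEuclideanLin
      (X : EuclideanSpace ℝ (Fin (n + 1))) :=
    (LinearMap.continuous_of_finiteDimensional _).comp continuous_subtype_val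
  have hX : Continuous fun X : Sph n => (X : EuclideanSpace ℝ (Fin (n + 1))) :=
    continuous_subtype_val
  exact h.sub (Continuous.smul (f := fun X : Sph n => inner ℝ (X : EuclideanSpace ℝ (Fin (n + 1)))
    ((projMatrix A B C D).toEuclideanLin X)) (hX.inner h) hX)

/-- The function is the restriction of a quadratic form, which is `C¹` and hence Lipschitz on the
closed ball, a compact convex set containing the sphere. -/
theorem exists_lipschitzWith_projBeta (p : ℝ) : ∃ L, LipschitzWith L (projBeta A B C D p) := by
  let M := (projMatrix A B C D).toEuclideanLin.toContinuousLinearMap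
  have h : ContDiff ℝ 1 fun y : EuclideanSpace ℝ (Fin (n + 1)) =>
      -(p + n + 1) * inner ℝ y (M y) :=
    contDiff_const.mul (contDiff_id.inner ℝ M.contDiff)
  obtain ⟨K, hK⟩ := h.contDiffOn.exists_lipschitzOnWith one_ne_zero
    (convex_closedBall (0 : EuclideanSpace ℝ (Fin (n + 1))) 1) (isCompact_closedBall _ _)
  exact ⟨K, fun X Y => hK (Metric.sphere_subset_closedBall X.2)
    (Metric.sphere_subset_closedBall Y.2)⟩

/-- The radial extension has no radial derivative, so the normal component of the linear field is
invisible to `f`. -/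
theorem dirDeriv_projField {f : Sph n → ℝ} (hf : ContMDiff (𝓡 n) 𝓘(ℝ) 1 f) (X : Sph n) :
    dirDeriv f X (projField A B C D X) =
      dirDeriv f X ((projMatrix A B C D).toEuclideanLin X) := by
  have hX : (X : EuclideanSpace ℝ (Fin (n + 1))) ≠ 0 := ne_zero_of_mem_unit_sphere X
  have h := fderiv_self_of_homogeneous_zero (fun r hr y => radialExt_smul f hr y)
    ((contDiffAt_radialExt (k := 1) hf hX).differentiableAt one_ne_zero)
  simp only [dirDeriv, projField, map_sub, map_smul, h, smul_zero, sub_zero]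

end LpMinkowski

theorem theorem1p2 (n : ℕ) (hn : 1 ≤ n) (p : ℝ) (hp : p ≤ -(n : ℝ) - 1)
    (A : Matrix (Fin n) (Fin n) ℝ) (hA : A.trace = 0)
    (B C : EuclideanSpace ℝ (Fin n)) (D : ℝ) :
    ∃ (ξ : Sph n → EuclideanSpace ℝ (Fin (n + 1))) (β : Sph n → ℝ),
      -- `ξ` is a continuous tangent field, given by the projective field on both hemispheres
      Continuous ξ ∧
      (∀ X : Sph n, inner ℝ (X : EuclideanSpace ℝ (Fin (n + 1))) (ξ X) = 0) ∧
      (∀ x, ξ (proj (-1) x) = pushVec (-1) x (affField A B C D x)) ∧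
      (∀ x, ξ (proj 1 x) = pushVec 1 x (affField A (-B) (-C) D x)) ∧
      -- `β` is a Lipschitz function, given by both formulas on both hemispheres
      (∃ L, LipschitzWith L β) ∧
      (∀ x, β (proj (-1) x) = betaFun p (affField A B C D) x ∧
        β (proj (-1) x) = betaExplicit p A B C D x) ∧
      (∀ x, β (proj 1 x) = betaFun p (affField A (-B) (-C) D) x ∧
        β (proj 1 x) = betaExplicit p A (-B) (-C) D x) ∧
      -- the identity
      ∀ f h : Sph n → ℝ, ContMDiff (𝓡 n) 𝓘(ℝ) 1 f → IsSolution n p f h →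
        MeasureTheory.Integrable
          (fun X => (dirDeriv f X (ξ X) + β X * f X) * h X ^ p) (surfaceMeasure n) ∧
        ∫ X, (dirDeriv f X (ξ X) + β X * f X) * h X ^ p ∂(surfaceMeasure n) = 0 := by
  have hneg : ∀ x, projBeta A B C D p (proj (-1) x) = betaFun p (affField A B C D) x := fun x => by
    simpa using projBeta_proj A B C D hA p (-1) x
  have hpos : ∀ x, projBeta A B C D p (proj 1 x) = betaFun p (affField A (-B) (-C) D) x :=
    fun x => by simpa using projBeta_proj A B C D hA p 1 x
  obtain ⟨L, hL⟩ := exists_lipschitzWith_projBeta A B C D p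
  refine ⟨projField A B C D, projBeta A B C D p, continuous_projField A B C D, fun X => ?_,
    fun x => by simpa using projField_proj A B C D (-1) x,
    fun x => by simpa using projField_proj A B C D 1 x, ⟨L, hL⟩,
    fun x => ⟨hneg x, (hneg x).trans (betaFun_affField _ _ _ _ hA p x)⟩,
    fun x => ⟨hpos x, (hpos x).trans (betaFun_affField _ _ _ _ hA p x)⟩, fun f h hf hh => ⟨?_, ?_⟩⟩
  · rw [projField, inner_sub_right, inner_smul_right, real_inner_self_eq_norm_sq,
      norm_eq_of_mem_sphere]
    ring
  · refine Continuous.integrable_toSphere MeasureTheory.volume ?_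
    exact (((continuous_fderiv_radialExt hf).clm_apply (continuous_projField A B C D)).add
      (hL.continuous.mul hf.continuous)).mul (hh.continuous_rpow p)
  · rw [← hh.integral_trace_zero hf (trace_projMatrix A B C D hA)]
    congr 1 with X
    rw [dirDeriv_projField A B C D hf, projBeta]
    ring
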